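/- Let $(X_1,Y_1),\dots,(X_{m+1},Y_{m+1})$ ($m\ge 1$) be random data points on a probability space, let $R(\cdot,\cdot)$ be a real-valued score function, and suppose that the scores $R_i = R(X_i,Y_i)$, $i=1,\dots,m+1$, are independent random variables with continuous (atomless), possibly different, distributions. Let $0<\alpha<1$. Let $R_{(1)}\le\dots\le R_{(m)}$ be the order statistics of the calibration scores $R_1,\dots,R_m$, with the convention $R_{(m+1)}=+\infty$, and define the split conformal prediction set and its modification \[ \widehat C_{m,\alpha}(X_{m+1}) = \{y : R(X_{m+1},y)\le R_{(\lceil (m+1)(1-\alpha)\rceil)}\},\qquad \widehat C^{\mathrm{mod}}_{m,\alpha}(X_{m+1}) = \{y : R(X_{m+1},y)\le R_{(m+1-\lfloor 2m\alpha/3\rfloor)}\}. \] For probability measures $\nu_1,\nu_2$ on $\mathbb R$ let $d_{\mathrm{KS}}(\nu_1,\nu_2)=\sup_{b\in\mathbb R}|\nu_1(-\infty,b]-\nu_2(-\infty,b]|$; for random variables or distribution functions, $d_{\mathrm{KS}}$ denotes the distance of the corresponding laws. Put $F_i(z)=\mathbb P(R_i<z)$ for $i\le m+1$, $\kappa_i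 = d_{\mathrm{KS}}(F_i,F_{m+1})$ for $i\le m$, $\overline F(z)=\frac1m\sum_{i=1}^m F_i(z)$, let $U$ be uniformly distributed on $(0,1)$, and let \[ I_m = \begin{cases} 1 & \text{if } m\le 4,\\ 1-\sqrt{1-\frac4m}+\frac2m\log\left(\frac{1+\sqrt{1-4/m}}{1-\sqrt{1-4/m}}\right) & \text{if } m>4.\end{cases} \] Then \[ -\delta \le \mathbb P\big(Y_{m+1}\in\widehat C_{m,\alpha}(X_{m+1})\big)-(1-\alpha)\le \frac1{m+1}+\delta, \] where \[ \delta = d_{\mathrm{KS}}(\overline F(R_{m+1}),U)+\Big(\sum_{i=1}^m\kappa_i^2\Big)\Big[I_m+d_{\mathrm{KS}}(\overline F(R_{m+1}),U)\Big], \] and moreover \[ \mathbb P\big(Y_{m+1}\in\widehat C^{\mathrm{mod}}_{m,\alpha}(X_{m+1})\big)-(1-\alpha)\ge -3\,d_{\mathrm{KS}}(\overline F(R_{m+1}),U). \] -/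

import Mathlib

open MeasureTheory ProbabilityTheory

namespace SplitConformal

noncomputable section

/-- Kolmogorov–Smirnov distance between two laws on the line,
`sup_b |ν₁(-∞, b] - ν₂(-∞, b]|`. The supremum is of a bounded family for probability measures. -/
def ksDist (ν₁ ν₂ : Measure ℝ) : ℝ :=
  ⨆ b : ℝ, |ν₁.real (Set.Iic b) - ν₂.real (Set.Iic b)|

/-- The uniform distribution `U(0,1)`. -/
def uniform01 : Measure ℝ := volume.restrict (Set.Ioo 0 1)

/-- The `k`-th smallest (`k = 1, …, m`) of the values `v 0, …, v (m-1)`, counted with multiplicity.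
By convention the order statistic of rank `0` is `-∞` and every order statistic of rank
larger than `m` is `+∞`. -/
def orderStat {m : ℕ} (v : Fin m → ℝ) (k : ℕ) : EReal :=
  if k = 0 then ⊥
  else if h : k - 1 < m then ((v (Tuple.sort v ⟨k - 1, h⟩) : ℝ) : EReal)
  else ⊤

/-- The prediction set `{y : R(x', y) ≤ R_(k)}` at the test point `x'`, where `R_(k)` is the `k`-th
order statistic of the calibration scores `R(x i, y i)`. -/
def predSet {𝒳 𝒴 : Type*} {m : ℕ} (R : 𝒳 → 𝒴 → ℝ) (x : Fin m → 𝒳) (y : Fin m → 𝒴)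
    (k : ℕ) (x' : 𝒳) : Set 𝒴 :=
  {y' | (R x' y' : EReal) ≤ orderStat (fun i => R (x i) (y i)) k}

/-- The split conformal prediction set, of rank `⌈(m+1)(1-α)⌉`. -/
def conformalSet {𝒳 𝒴 : Type*} {m : ℕ} (R : 𝒳 → 𝒴 → ℝ) (x : Fin m → 𝒳) (y : Fin m → 𝒴)
    (α : ℝ) (x' : 𝒳) : Set 𝒴 :=
  predSet R x y ⌈((m : ℝ) + 1) * (1 - α)⌉₊ x'

/-- The modified prediction set, of rank `m + 1 - ⌊2mα/3⌋`. The subtraction does not truncate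
for `α ≤ 1`. -/
def modConformalSet {𝒳 𝒴 : Type*} {m : ℕ} (R : 𝒳 → 𝒴 → ℝ) (x : Fin m → 𝒳) (y : Fin m → 𝒴)
    (α : ℝ) (x' : 𝒳) : Set 𝒴 :=
  predSet R x y (m + 1 - ⌊2 * (m : ℝ) * α / 3⌋₊) x'

/-- The constant `I_B`. -/
def IConst (B : ℕ) : ℝ :=
  if B ≤ 4 then 1
  else 1 - √(1 - 4 / (B : ℝ)) +
    2 / (B : ℝ) * Real.log ((1 + √(1 - 4 / (B : ℝ))) / (1 - √(1 - 4 / (B : ℝ))))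

variable {Ω : Type*} [MeasurableSpace Ω]

/-- `F(z) = P(S < z)`. -/
def strictCDF (P : Measure Ω) (S : Ω → ℝ) (z : ℝ) : ℝ := P.real {ω | S ω < z}

/-- `F̄(z) = (1/m) ∑_{i ≤ m} P(S_i < z)`, the average over the calibration scores; the test score
is the last one. -/
def avgCDF {m : ℕ} (P : Measure Ω) (S : Fin (m + 1) → Ω → ℝ) (z : ℝ) : ℝ :=
  (1 / (m : ℝ)) * ∑ i : Fin m, strictCDF P (S i.castSucc) z

/-- `d_KS(F̄(S_{m+1}), U(0,1))`. -/
def avgKS {m : ℕ} (P : Measure Ω) (S : Fin (m + 1) → Ω → ℝ) : ℝ :=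
  ksDist (P.map (fun ω => avgCDF P S (S (Fin.last m) ω))) uniform01

/-- `κ_i = d_KS(S_i, S_{m+1})`. -/
def kappa {m : ℕ} (P : Measure Ω) (S : Fin (m + 1) → Ω → ℝ) (i : Fin m) : ℝ :=
  ksDist (P.map (S i.castSucc)) (P.map (S (Fin.last m)))

/-- `δ = d_KS(F̄(S_{m+1}), U) + (∑ κ_i²) (I_m + d_KS(F̄(S_{m+1}), U))`. -/
def slack {m : ℕ} (P : Measure Ω) (S : Fin (m + 1) → Ω → ℝ) : ℝ :=
  avgKS P S + (∑ i : Fin m, kappa P S i ^ 2) * (IConst m + avgKS P S)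

end

end SplitConformal

/-! Condition on the test score being `z`. The number `N` of calibration scores below `z` is then a
sum of `m` independent Bernoulli variables with success probabilities `p i = F_i(z)`, and the set of
rank `k` covers exactly when `N < k`. Had `N` the binomial law with the same mean, coverage would be
a binomial distribution function evaluated at `a = F̄(z)`, and this integrates to `k / (m + 1)`
against a uniform parameter. Two errors must be controlled.

Poisson-binomial against binomial: the distribution functions differ by at most `min (1/2) (1/(m a
(1-a)))` times `∑ (p i - a)^2` (`abs_coeffSum_below_sub_le`). The constant `1/2` comes from
interpolating the probabilities, the other from Stein's method. In both, `∑ (p i - a) = 0` permits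
symmetrising over pairs of trials, which removes the linear term (`abs_sum_mul_le_of_pairs`). The
mean minimises the sum of squares, so that sum is at most `∑ κ_i^2`.

Law of `F̄(R_{m+1})` against uniform: integrals of bounded monotone functions move by at most their
range times the Kolmogorov–Smirnov distance. This applies to the binomial distribution function, and
to the weight above, whose uniform integral is at most `I_m`.

For the modified set no binomial comparison is needed. Chernoff's bound for `N ≥ k` depends on the
`p i` only through their mean, and with `c = m - k` its uniform integral is at most `3(c + 1)/(2m)`.
The choice `c + 1 = ⌊2mα/3⌋` makes this at most `α`, and one Kolmogorov–Smirnov distance is lost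
instead of the three allowed. -/

namespace SplitConformal
open Polynomial Finset

/-! ### Expectations through generating polynomials. -/

/-- The linear functional sending `∑ a_j X^j` to `∑ a_j φ j`. On the generating polynomial of an
`ℕ`-valued random variable it is the expectation of `φ`. -/
noncomputable def coeffSum (φ : ℕ → ℝ) : ℝ[X] →ₗ[ℝ] ℝ :=
  Polynomial.lsum fun n => φ n • LinearMap.id

lemma coeffSum_monomial (φ : ℕ → ℝ) (n : ℕ) (a : ℝ) :
    coeffSum φ (monomial n a) = φ n * a := by
  simp [coeffSum, Polynomial.lsum_apply, Polynomial.sum_monomial_index]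

lemma coeffSum_X_mul (φ : ℕ → ℝ) (P : ℝ[X]) :
    coeffSum φ (X * P) = coeffSum (fun n => φ (n + 1)) P := by
  induction P using Polynomial.induction_on' with
  | add P Q hP hQ => rw [mul_add, map_add, map_add, hP, hQ]
  | monomial n a => rw [X_mul_monomial, coeffSum_monomial, coeffSum_monomial]

/-- Multiplication by `X - 1` is adjoint to the forward difference of the test function. Varying a
success probability produces such a factor. -/
lemma coeffSum_X_sub_one_mul (φ : ℕ → ℝ) (P : ℝ[X]) :
    coeffSum φ ((X - 1) * P) = coeffSum (fun n => φ (n + 1) - φ n) P := by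
  induction P using Polynomial.induction_on' with
  | add P Q hP hQ => rw [mul_add, map_add, map_add, hP, hQ]
  | monomial n a =>
    rw [sub_mul, one_mul, map_sub, X_mul_monomial]
    simp only [coeffSum_monomial]; ring

lemma coeffSum_eq_sum_range (φ : ℕ → ℝ) {P : ℝ[X]} {n : ℕ} (h : P.natDegree ≤ n) :
    coeffSum φ P = ∑ j ∈ range (n + 1), P.coeff j * φ j := by
  rw [coeffSum, Polynomial.lsum_apply, Polynomial.sum_over_range' _ (by simp) (n + 1) (by lia)]
  simp [mul_comm]

lemma coeffSum_congr {φ ψ : ℕ → ℝ} {P : ℝ[X]} {n : ℕ} (h : P.natDegree ≤ n)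
    (hφ : ∀ j ≤ n, φ j = ψ j) : coeffSum φ P = coeffSum ψ P := by
  rw [coeffSum_eq_sum_range _ h, coeffSum_eq_sum_range _ h]
  refine sum_congr rfl fun j hj => ?_
  rw [hφ j (by simpa [Nat.lt_succ_iff] using hj)]

lemma coeffSum_mono {φ ψ : ℕ → ℝ} {P : ℝ[X]} {n : ℕ} (h : P.natDegree ≤ n)
    (h0 : ∀ j, 0 ≤ P.coeff j) (hφ : ∀ j ≤ n, φ j ≤ ψ j) : coeffSum φ P ≤ coeffSum ψ P := by
  rw [coeffSum_eq_sum_range _ h, coeffSum_eq_sum_range _ h]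
  refine sum_le_sum fun j hj => ?_
  exact mul_le_mul_of_nonneg_left (hφ j (by simpa [Nat.lt_succ_iff] using hj)) (h0 j)

lemma coeffSum_const (c : ℝ) (P : ℝ[X]) : coeffSum (fun _ => c) P = c * P.eval 1 := by
  induction P using Polynomial.induction_on' with
  | add P Q hP hQ => rw [map_add, eval_add, hP, hQ]; ring
  | monomial n a => simp [coeffSum_monomial]

lemma coeffSum_mul_left (c : ℝ) (φ : ℕ → ℝ) (P : ℝ[X]) :
    coeffSum (fun j => c * φ j) P = c * coeffSum φ P := by
  induction P using Polynomial.induction_on' with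
  | add P Q hP hQ => rw [map_add, map_add, hP, hQ]; ring
  | monomial n a => simp [coeffSum_monomial]; ring

lemma coeffSum_sub (φ ψ : ℕ → ℝ) (P : ℝ[X]) :
    coeffSum (fun j => φ j - ψ j) P = coeffSum φ P - coeffSum ψ P := by
  induction P using Polynomial.induction_on' with
  | add P Q hP hQ => rw [map_add, map_add, map_add, hP, hQ]; ring
  | monomial n a => simp [coeffSum_monomial]; ring

lemma abs_coeffSum_le {φ : ℕ → ℝ} {P : ℝ[X]} {n : ℕ} {c : ℝ} (h : P.natDegree ≤ n)
    (h0 : ∀ j, 0 ≤ P.coeff j) (h1 : P.eval 1 = 1) (hφ : ∀ j ≤ n, |φ j| ≤ c) :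
    |coeffSum φ P| ≤ c := by
  rw [abs_le]
  constructor
  · have := coeffSum_mono (φ := fun _ => -c) h h0 fun j hj => (abs_le.1 (hφ j hj)).1
    rwa [coeffSum_const, h1, mul_one] at this
  · have := coeffSum_mono (ψ := fun _ => c) h h0 fun j hj => (abs_le.1 (hφ j hj)).2
    rwa [coeffSum_const, h1, mul_one] at this

variable {ι : Type*}

/-- The generating polynomial of a sum of independent Bernoulli variables with success
probabilities `p i`, `i ∈ s`. -/
noncomputable def bernProd (s : Finset ι) (p : ι → ℝ) : ℝ[X] :=
  ∏ i ∈ s, (C (1 - p i) + C (p i) * X)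

lemma bernProd_eval_one (s : Finset ι) (p : ι → ℝ) : (bernProd s p).eval 1 = 1 := by
  simp [bernProd, eval_prod]

lemma bernProd_natDegree_le (s : Finset ι) (p : ι → ℝ) : (bernProd s p).natDegree ≤ #s := by
  refine (natDegree_prod_le _ _).trans ?_
  refine (sum_le_sum (g := fun _ => 1) fun i _ => ?_).trans (by simp)
  compute_degree

lemma bernProd_coeff_nonneg (s : Finset ι) {p : ι → ℝ} (h0 : ∀ i, 0 ≤ p i) (h1 : ∀ i, p i ≤ 1)
    (j : ℕ) : 0 ≤ (bernProd s p).coeff j := by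
  classical
  induction s using Finset.induction_on generalizing j with
  | empty => simp only [bernProd, prod_empty, coeff_one]; split_ifs <;> norm_num
  | insert a s ha ih =>
    have e : bernProd (insert a s) p
        = C (1 - p a) * bernProd s p + C (p a) * (X * bernProd s p) := by
      simp only [bernProd, prod_insert ha]; ring
    rw [e, coeff_add, coeff_C_mul, coeff_C_mul]
    have hX : 0 ≤ (X * bernProd s p).coeff j := by
      cases j with
      | zero => simp
      | succ j => rw [coeff_X_mul]; exact ih j
    have := ih j
    have := h0 a
    have := h1 a
    have : 0 ≤ 1 - p a := by linarith
    positivity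

lemma coeffSum_bernProd_univ [Fintype ι] [DecidableEq ι] (φ : ℕ → ℝ) (p : ι → ℝ) :
    coeffSum φ (bernProd univ p)
      = ∑ T : Finset ι, (∏ i ∈ T, p i) * (∏ i ∈ Tᶜ, (1 - p i)) * φ #T := by
  have e : bernProd univ p = ∏ i, (C (p i) * X + C (1 - p i)) := by
    simp only [bernProd, add_comm]
  rw [e, Finset.prod_add, map_sum, powerset_univ]
  refine sum_congr rfl fun T _ => ?_
  rw [prod_mul_distrib, prod_const, ← map_prod, ← map_prod, ← compl_eq_univ_sdiff,
    mul_right_comm, ← C_mul, C_mul_X_pow_eq_monomial, coeffSum_monomial, mul_comm]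

/-! ### Symmetrisation over pairs of trials, and the interpolation bound. -/

section pairs

variable [Fintype ι]

lemma sum_sum_sub_mul_sub {d : ι → ℝ} (hd : ∑ i, d i = 0) (b : ι → ℝ) :
    ∑ i, ∑ j, (d i - d j) * (b i - b j) = 2 * Fintype.card ι * ∑ i, d i * b i := by
  have e : ∀ i, ∑ j, (d i - d j) * (b i - b j)
      = Fintype.card ι * (d i * b i) - d i * ∑ j, b j - (∑ j, d j) * b i + ∑ j, d j * b j := by
    intro i
    simp only [sub_mul, mul_sub, sum_sub_distrib, mul_sum, sum_mul, sum_const, card_univ,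
      nsmul_eq_mul]
    ring
  simp only [e, hd, zero_mul, sub_zero, sum_add_distrib, sum_sub_distrib, ← mul_sum, ← sum_mul,
    sum_const, card_univ, nsmul_eq_mul]
  ring

variable [DecidableEq ι]

/-- Both products share the factors of the remaining trials; the two leftover linear factors differ
by `(p j - p i)(X - 1)`. -/
lemma bernProd_erase_sub (p : ι → ℝ) {i j : ι} (h : i ≠ j) :
    bernProd (univ.erase i) p - bernProd (univ.erase j) p
      = C (p j - p i) * ((X - 1) * bernProd ((univ.erase i).erase j) p) := by
  have hi : bernProd (univ.erase i) p
      = (C (1 - p j) + C (p j) * X) * bernProd ((univ.erase i).erase j) p :=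
    (mul_prod_erase _ _ (by simp [h.symm])).symm
  have hj : bernProd (univ.erase j) p
      = (C (1 - p i) + C (p i) * X) * bernProd ((univ.erase i).erase j) p := by
    rw [erase_right_comm]
    exact (mul_prod_erase _ _ (by simp [h])).symm
  rw [hi, hj]
  simp only [C_sub, C_1]
  ring

/-- The second-order gain. After symmetrisation the weight `d i - d j` meets a difference of two
leave-one-out laws, which supplies another factor `t (d i - d j)`. The interpolation uses every `t`
in `[0, 1)`, Stein's method only `t = 1`. -/
lemma abs_sum_mul_le_of_pairs {a t c : ℝ} (ht : 0 ≤ t) {d : ι → ℝ} (hd : ∑ i, d i = 0)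
    (ℓ : ℝ[X] →ₗ[ℝ] ℝ)
    (hℓ : ∀ i j, i ≠ j →
      |ℓ ((X - 1) * bernProd ((univ.erase i).erase j) fun i => a + t * d i)| ≤ c) :
    |∑ i, d i * ℓ (bernProd (univ.erase i) fun i => a + t * d i)| ≤ c * t * ∑ i, d i ^ 2 := by
  rcases isEmpty_or_nonempty ι with hι | hι
  · simp
  have hn : 0 < (2 * Fintype.card ι : ℝ) := by
    have : 0 < (Fintype.card ι : ℝ) := by exact_mod_cast Fintype.card_pos
    linarith
  set p : ι → ℝ := fun i => a + t * d i with hp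
  rw [← mul_le_mul_iff_right₀ hn, ← abs_of_pos hn, ← abs_mul, abs_of_pos hn,
    ← sum_sum_sub_mul_sub hd]
  have e2 : 2 * (Fintype.card ι : ℝ) * (c * t * ∑ i, d i ^ 2)
      = ∑ i, ∑ j, c * t * ((d i - d j) * (d i - d j)) := by
    simp only [← mul_sum]
    rw [sum_sum_sub_mul_sub hd]
    simp only [pow_two]; ring
  rw [e2]
  refine (abs_sum_le_sum_abs _ _).trans (sum_le_sum fun i _ => ?_)
  refine (abs_sum_le_sum_abs _ _).trans (sum_le_sum fun j _ => ?_)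
  by_cases h : i = j
  · simp [h]
  rw [← map_sub, bernProd_erase_sub p h, ← smul_eq_C_mul, map_smul, smul_eq_mul]
  have e3 : p j - p i = -(t * (d i - d j)) := by simp only [hp]; ring
  rw [e3, ← mul_assoc, abs_mul]
  have e4 : |(d i - d j) * -(t * (d i - d j))| = t * ((d i - d j) * (d i - d j)) := by
    rw [mul_neg, abs_neg, abs_of_nonneg]
    · ring
    · have := mul_nonneg ht (mul_self_nonneg (d i - d j)); nlinarith
  rw [e4]
  have := mul_le_mul_of_nonneg_left (hℓ i j h)
    (mul_nonneg ht (mul_self_nonneg (d i - d j)))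
  linarith

end pairs

/-- Product rule: each linear factor has derivative `d i (X - 1)`. The induction needs `ℓ`
arbitrary, because a new factor is absorbed by composing `ℓ` with multiplication by `X - 1`. -/
lemma hasDerivAt_linear_bernProd [DecidableEq ι] (a : ℝ) (d : ι → ℝ) (s : Finset ι)
    (ℓ : ℝ[X] →ₗ[ℝ] ℝ) (t : ℝ) :
    HasDerivAt (fun t => ℓ (bernProd s fun i => a + t * d i))
      (∑ i ∈ s, d i * ℓ ((X - 1) * bernProd (s.erase i) fun i => a + t * d i)) t := by
  induction s using Finset.induction_on generalizing ℓ with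
  | empty => simpa [bernProd] using hasDerivAt_const t (ℓ 1)
  | insert b s hb ih =>
    have e : ∀ u : ℝ, ℓ (bernProd (insert b s) fun i => a + u * d i)
        = ℓ (bernProd s fun i => a + u * d i)
          + (a + u * d b) * (ℓ ∘ₗ LinearMap.mulLeft ℝ (X - 1)) (bernProd s fun i => a + u * d i) := by
      intro u
      rw [LinearMap.comp_apply, LinearMap.mulLeft_apply, ← smul_eq_mul, ← map_smul, ← map_add,
        smul_eq_C_mul]
      congr 1
      rw [bernProd, prod_insert hb, ← bernProd, C_sub, C_1]
      ring
    simp only [e]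
    have hlin : HasDerivAt (fun u : ℝ => a + u * d b) (d b) t := by
      simpa using ((hasDerivAt_id t).mul_const (d b)).const_add a
    refine ((ih ℓ).add (hlin.mul (ih (ℓ ∘ₗ LinearMap.mulLeft ℝ (X - 1))))).congr_deriv (Eq.symm ?_)
    rw [sum_insert hb, erase_insert hb, mul_sum]
    simp only [LinearMap.comp_apply, LinearMap.mulLeft_apply]
    rw [add_left_comm, ← sum_add_distrib]
    congr 1
    refine sum_congr rfl fun i hi => ?_
    have hib : i ≠ b := fun h => hb (h ▸ hi)
    have e2 : (bernProd ((insert b s).erase i) fun i => a + t * d i)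
        = (C (1 - (a + t * d b)) + C (a + t * d b) * X)
          * bernProd (s.erase i) fun i => a + t * d i := by
      rw [erase_insert_of_ne hib.symm, bernProd, prod_insert (by simp [hb]), ← bernProd]
    have e3 : (X - 1) * ((C (1 - (a + t * d b)) + C (a + t * d b) * X)
          * bernProd (s.erase i) fun i => a + t * d i)
        = ((X - 1) * bernProd (s.erase i) fun i => a + t * d i)
          + (a + t * d b) • ((X - 1) * ((X - 1) * bernProd (s.erase i) fun i => a + t * d i)) := by
      rw [smul_eq_C_mul, C_sub, C_1]; ring
    rw [e2, e3, map_add, map_smul, smul_eq_mul]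
    ring

/-- The indicator of `{0, …, k - 1}`. -/
noncomputable def below (k j : ℕ) : ℝ := if j < k then 1 else 0

lemma abs_below_second_diff_le (k j : ℕ) :
    |below k (j + 1 + 1) - below k (j + 1) - (below k (j + 1) - below k j)| ≤ 1 := by
  unfold below
  split_ifs <;> first | lia | norm_num

lemma convex_interp_mem {a t x : ℝ} (ha : a ∈ Set.Icc (0 : ℝ) 1) (hx : x ∈ Set.Icc (0 : ℝ) 1)
    (ht : t ∈ Set.Icc (0 : ℝ) 1) : a + t * (x - a) ∈ Set.Icc (0 : ℝ) 1 := by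
  have := (convex_Icc (0 : ℝ) 1).add_smul_sub_mem ha hx ht
  simpa using this

/-- Replacing the success probabilities by their mean changes the distribution function of a sum
of independent Bernoulli variables by at most half of the sum of the squared deviations. -/
theorem abs_coeffSum_below_sub_le_half [Fintype ι] {p : ι → ℝ} {a : ℝ}
    (hp : ∀ i, p i ∈ Set.Icc (0 : ℝ) 1) (ha : a ∈ Set.Icc (0 : ℝ) 1)
    (hsum : ∑ i, (p i - a) = 0) (k : ℕ) :
    |coeffSum (below k) (bernProd univ p) - coeffSum (below k) (bernProd univ fun _ : ι => a)|
      ≤ (1 / 2) * ∑ i, (p i - a) ^ 2 := by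
  classical
  set d : ι → ℝ := fun i => p i - a with hd
  set F : ℝ → ℝ := fun t => coeffSum (below k) (bernProd univ fun i => a + t * d i) with hF
  have hderiv := fun t => hasDerivAt_linear_bernProd a d univ (coeffSum (below k)) t
  set F' : ℝ → ℝ := fun t =>
    ∑ i, d i * coeffSum (below k) ((X - 1) * bernProd (univ.erase i) fun i => a + t * d i) with hF'
  have hbound : ∀ t ∈ Set.Ico (0 : ℝ) 1, ‖F' t‖ ≤ (∑ i, d i ^ 2) * t := by
    intro t ht
    have hm : ∀ i, a + t * d i ∈ Set.Icc (0 : ℝ) 1 := fun i =>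
      convex_interp_mem ha (hp i) ⟨ht.1, ht.2.le⟩
    have := abs_sum_mul_le_of_pairs (a := a) (c := 1) ht.1 hsum
      (coeffSum (below k) ∘ₗ LinearMap.mulLeft ℝ (X - 1)) (by
        intro i j _
        rw [LinearMap.comp_apply, LinearMap.mulLeft_apply, coeffSum_X_sub_one_mul,
          coeffSum_X_sub_one_mul]
        exact abs_coeffSum_le le_rfl (bernProd_coeff_nonneg _ (fun i => (hm i).1)
          fun i => (hm i).2) (bernProd_eval_one _ _) fun j _ => abs_below_second_diff_le k j)
    simp only [LinearMap.comp_apply, LinearMap.mulLeft_apply] at this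
    rw [Real.norm_eq_abs]
    linarith
  -- The derivative is at most `t ∑ d i ^ 2`; integrating `t` over `[0, 1]` gives the factor `1/2`.
  have key := image_norm_le_of_norm_deriv_right_le_deriv_boundary
    (f := fun t => F t - F 0) (f' := F') (a := 0) (b := 1)
    (B := fun t => (1 / 2) * (∑ i, d i ^ 2) * t ^ 2) (B' := fun t => (∑ i, d i ^ 2) * t)
    (fun t _ => ((hderiv t).sub_const _).continuousAt.continuousWithinAt)
    (fun t _ => ((hderiv t).sub_const _).hasDerivWithinAt)
    (by simp)
    (fun t => by
      refine ((hasDerivAt_pow 2 t).const_mul ((1 / 2) * (∑ i, d i ^ 2))).congr_deriv ?_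
      norm_num; ring)
    hbound (x := 1) (by simp)
  simpa [hF, hd, Real.norm_eq_abs] using key

end SplitConformal

/-! ### Binomial probabilities. -/

namespace SplitConformal
open Polynomial Finset

/-- The binomial probability of `j`. -/
noncomputable def binPMF (n : ℕ) (p : ℝ) (j : ℕ) : ℝ := n.choose j * p ^ j * (1 - p) ^ (n - j)

/-- The binomial probability of `{0, …, k - 1}`. -/
noncomputable def binCDF (n : ℕ) (p : ℝ) (k : ℕ) : ℝ := ∑ j ∈ range k, binPMF n p j

lemma binCDF_succ (n : ℕ) (p : ℝ) (k : ℕ) :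
    binCDF n p (k + 1) = binCDF n p k + binPMF n p k := sum_range_succ _ _

lemma binCDF_zero (n : ℕ) (p : ℝ) : binCDF n p 0 = 0 := sum_range_zero _

lemma binCDF_self_succ (n : ℕ) (p : ℝ) : binCDF n p (n + 1) = 1 := by
  have := add_pow p (1 - p) n
  rw [add_sub_cancel, one_pow] at this
  rw [this]
  exact sum_congr rfl fun j _ => by unfold binPMF; ring

lemma binPMF_nonneg {n : ℕ} {p : ℝ} (h0 : 0 ≤ p) (h1 : p ≤ 1) (j : ℕ) : 0 ≤ binPMF n p j := by
  have : 0 ≤ 1 - p := by linarith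
  unfold binPMF; positivity

lemma binPMF_pos {n : ℕ} {p : ℝ} (h0 : 0 < p) (h1 : p < 1) {j : ℕ} (hj : j ≤ n) :
    0 < binPMF n p j := by
  have : 0 < 1 - p := by linarith
  have : 0 < n.choose j := Nat.choose_pos hj
  unfold binPMF; positivity

lemma binCDF_mono {n : ℕ} {p : ℝ} (h0 : 0 ≤ p) (h1 : p ≤ 1) : Monotone (binCDF n p) :=
  monotone_nat_of_le_succ fun k => by
    rw [binCDF_succ]; linarith [binPMF_nonneg (n := n) h0 h1 k]

lemma binCDF_nonneg {n : ℕ} {p : ℝ} (h0 : 0 ≤ p) (h1 : p ≤ 1) (k : ℕ) : 0 ≤ binCDF n p k :=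
  sum_nonneg fun j _ => binPMF_nonneg h0 h1 j

lemma binCDF_le_one {n : ℕ} {p : ℝ} (h0 : 0 ≤ p) (h1 : p ≤ 1) {k : ℕ} (hk : k ≤ n + 1) :
    binCDF n p k ≤ 1 := by
  rw [← binCDF_self_succ n p]; exact binCDF_mono h0 h1 hk

lemma coeffSum_bernProd_const {ι : Type*} [Fintype ι] (φ : ℕ → ℝ) (a : ℝ) :
    coeffSum φ (bernProd univ fun _ : ι => a)
      = ∑ j ∈ range (Fintype.card ι + 1), binPMF (Fintype.card ι) a j * φ j := by
  classical
  rw [coeffSum_bernProd_univ]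
  simp only [prod_const, card_compl]
  rw [← powerset_univ, sum_powerset_apply_card
    (fun j => a ^ j * (1 - a) ^ (Fintype.card ι - j) * φ j), card_univ]
  refine sum_congr rfl fun j _ => ?_
  rw [nsmul_eq_mul, binPMF]; ring

lemma coeffSum_below_bernProd_const {ι : Type*} [Fintype ι] (a : ℝ) {k : ℕ}
    (hk : k ≤ Fintype.card ι + 1) :
    coeffSum (below k) (bernProd univ fun _ : ι => a) = binCDF (Fintype.card ι) a k := by
  rw [coeffSum_bernProd_const, binCDF]
  simp only [below, mul_ite, mul_one, mul_zero]
  rw [← sum_filter]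
  refine sum_congr ?_ fun _ _ => rfl
  ext j; simp; lia

/-- Detailed balance for birth rate `(n - j) p` and death rate `j (1 - p)`, the coefficients of the
binomial Stein equation. -/
lemma binPMF_succ_rec (n : ℕ) (p : ℝ) {j : ℕ} (hj : j ≤ n) :
    ((n : ℝ) - j) * p * binPMF n p j = (j + 1) * (1 - p) * binPMF n p (j + 1) := by
  have h : (n.choose (j + 1) : ℝ) * (j + 1) = n.choose j * ((n : ℝ) - j) := by
    have := Nat.choose_succ_right_eq n j
    rw [← Nat.cast_sub hj]; exact_mod_cast this
  rcases hj.eq_or_lt with rfl | hj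
  · simp [binPMF]
  have e : n - j = n - (j + 1) + 1 := by lia
  unfold binPMF
  rw [e, pow_succ, pow_succ]
  linear_combination (-(p ^ j * p * (1 - p) ^ (n - (j + 1)) * (1 - p))) * h

lemma binPMF_upper (n : ℕ) (p : ℝ) {j : ℕ} (hj : j ≤ n) :
    (1 - p) * (n + 1) * binPMF n p j = ((n : ℝ) + 1 - j) * binPMF (n + 1) p j := by
  have h : (n.choose j : ℝ) * (n + 1) = (n + 1).choose j * ((n : ℝ) + 1 - j) := by
    have := Nat.choose_mul_succ_eq n j
    have h2 : ((n : ℝ) + 1 - j) = ((n + 1 - j : ℕ) : ℝ) := by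
      rw [Nat.cast_sub (by lia)]; push_cast; ring
    rw [h2]; exact_mod_cast this
  have e : n + 1 - j = n - j + 1 := by lia
  unfold binPMF
  rw [e, pow_succ]
  linear_combination (p ^ j * (1 - p) ^ (n - j) * (1 - p)) * h

lemma binPMF_lower (n : ℕ) (p : ℝ) (j : ℕ) :
    p * (n + 1) * binPMF n p j = ((j : ℝ) + 1) * binPMF (n + 1) p (j + 1) := by
  have h : ((n : ℝ) + 1) * n.choose j = (n + 1).choose (j + 1) * (j + 1) := by
    exact_mod_cast Nat.add_one_mul_choose_eq n j
  unfold binPMF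
  rw [Nat.add_sub_add_right, pow_succ]
  linear_combination (p ^ j * p * (1 - p) ^ (n - j)) * h

/-! ### The Stein solution and its increments. -/

section bounds

variable {n : ℕ} {p : ℝ}

/-- In cross-multiplied form, the Stein solution is nondecreasing up to `k`; `binTail_ratio_anti`
makes it nonincreasing from `k` on. -/
lemma binCDF_ratio_mono (h0 : 0 ≤ p) (h1 : p ≤ 1) {j : ℕ} (hj : j ≤ n) :
    binCDF n p j * (((n : ℝ) - j) * p) ≤ binCDF n p (j + 1) * (j * (1 - p)) := by
  have hq : 0 ≤ 1 - p := by linarith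
  induction j with
  | zero => simp [binCDF_zero]
  | succ j ih =>
    have hB := binCDF_nonneg (n := n) h0 h1 (j + 1)
    have := ih (by lia)
    have e := binPMF_succ_rec n p (j := j) (by lia)
    have e1 := binCDF_succ n p j
    have e2 := binCDF_succ n p (j + 1)
    push_cast at *
    have t1 := mul_nonneg hB h0
    have t2 := mul_nonneg hB hq
    rw [e2]
    rw [e1] at t1 t2 this ⊢
    nlinarith

lemma binTail_ratio_anti (h0 : 0 ≤ p) (h1 : p ≤ 1) {j : ℕ} (hj : j ≤ n) :
    (1 - binCDF n p (j + 1)) * (j * (1 - p)) ≤ (1 - binCDF n p j) * (((n : ℝ) - j) * p) := by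
  have hq : 0 ≤ 1 - p := by linarith
  induction hj using Nat.decreasingInduction with
  | self => simp [binCDF_self_succ]
  | of_succ j hj ih =>
    have hT : 0 ≤ 1 - binCDF n p (j + 1) := by
      linarith [binCDF_le_one (n := n) h0 h1 (k := j + 1) (by lia)]
    have e := binPMF_succ_rec n p (j := j) (by lia)
    have e1 := binCDF_succ n p j
    have e2 := binCDF_succ n p (j + 1)
    push_cast at *
    have t1 := mul_nonneg hT h0
    have t2 := mul_nonneg hT hq
    have e3 : binCDF n p j = binCDF n p (j + 1) - binPMF n p j := by linarith
    rw [e2] at ih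
    rw [e3]
    nlinarith

/-- `binPMF_lower` and `binPMF_upper` bound the two terms by complementary probabilities of the
binomial law with `n + 1` trials, each divided by `(n + 1) p (1 - p)`; these probabilities add up to
`1`. -/
lemma binTail_add_binCDF_le (h0 : 0 < p) (h1 : p < 1) {j : ℕ} (hj0 : 0 < j) (hj : j < n) :
    (1 - binCDF n p (j + 1)) / (((n : ℝ) - j) * p) + binCDF n p j / (j * (1 - p))
      ≤ 1 / (n * p * (1 - p)) := by
  have hq : 0 < 1 - p := by linarith
  have hjn : (0 : ℝ) < (n : ℝ) - j := by
    have : (j : ℝ) < n := by exact_mod_cast hj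
    linarith
  have hj0' : (0 : ℝ) < j := by exact_mod_cast hj0
  have hn : (0 : ℝ) < n := by linarith
  have hlow : binCDF n p j * (p * (n + 1)) ≤ j * (binCDF (n + 1) p (j + 1)) := by
    have : binCDF n p j * (p * (n + 1)) ≤ ∑ l ∈ range j, j * binPMF (n + 1) p (l + 1) := by
      rw [binCDF, sum_mul]
      refine sum_le_sum fun l hl => ?_
      have hl' : (l : ℝ) + 1 ≤ j := by exact_mod_cast mem_range.1 hl
      have := mul_le_mul_of_nonneg_right hl' (binPMF_nonneg (n := n + 1) h0.le h1.le (l + 1))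
      linarith [binPMF_lower n p l]
    rw [← mul_sum] at this
    refine this.trans (mul_le_mul_of_nonneg_left ?_ hj0'.le)
    rw [binCDF, sum_range_succ']
    linarith [binPMF_nonneg (n := n + 1) h0.le h1.le 0]
  have htail : ∀ m : ℕ, ∀ i, 1 - binCDF m p i = ∑ l ∈ Ico i (m + 1), binPMF m p l ∨ m + 1 < i := by
    intro m i
    by_cases h : m + 1 < i
    · exact Or.inr h
    · left
      rw [← binCDF_self_succ m p, binCDF, binCDF, sum_Ico_eq_sub _ (by lia)]
  have hup : (1 - binCDF n p (j + 1)) * ((1 - p) * (n + 1))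
      ≤ (n - j) * (1 - binCDF (n + 1) p (j + 1)) := by
    rw [(htail n (j + 1)).resolve_right (by lia), (htail (n + 1) (j + 1)).resolve_right (by lia),
      sum_mul, mul_sum, sum_Ico_succ_top (show j + 1 ≤ n + 1 by lia)]
    have h2 : 0 ≤ ((n : ℝ) - j) * binPMF (n + 1) p (n + 1) :=
      mul_nonneg hjn.le (binPMF_nonneg h0.le h1.le _)
    refine le_add_of_le_of_nonneg (sum_le_sum fun l hl => ?_) h2
    rw [mem_Ico] at hl
    have hl' : (n : ℝ) + 1 - l ≤ n - j := by
      have : (j : ℝ) + 1 ≤ l := by exact_mod_cast hl.1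
      linarith
    have := mul_le_mul_of_nonneg_right hl' (binPMF_nonneg (n := n + 1) h0.le h1.le l)
    linarith [binPMF_upper n p (j := l) (by lia)]
  have a1 : (1 - binCDF n p (j + 1)) / (((n : ℝ) - j) * p)
      ≤ (1 - binCDF (n + 1) p (j + 1)) / ((n + 1) * p * (1 - p)) := by
    rw [div_le_div_iff₀ (by positivity) (by positivity)]
    have := mul_le_mul_of_nonneg_right hup h0.le
    linarith
  have a2 : binCDF n p j / (j * (1 - p))
      ≤ binCDF (n + 1) p (j + 1) / ((n + 1) * p * (1 - p)) := by
    rw [div_le_div_iff₀ (by positivity) (by positivity)]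
    have := mul_le_mul_of_nonneg_right hlow hq.le
    linarith
  calc _ ≤ (1 - binCDF (n + 1) p (j + 1)) / ((n + 1) * p * (1 - p))
        + binCDF (n + 1) p (j + 1) / ((n + 1) * p * (1 - p)) := add_le_add a1 a2
    _ = 1 / ((n + 1) * p * (1 - p)) := by rw [← add_div]; congr 1; ring
    _ ≤ 1 / (n * p * (1 - p)) := by gcongr; linarith

/-- The solution of the Stein equation of the binomial law for the half-line `{0, …, k - 1}`. -/
noncomputable def steinSol (n : ℕ) (p : ℝ) (k j : ℕ) : ℝ :=
  binCDF n p (min j k) * (1 - binCDF n p (max j k)) / (j * (1 - p) * binPMF n p j)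

lemma mul_steinSol (h0 : 0 < p) (h1 : p < 1) (k : ℕ) {j : ℕ} (hj : j ≤ n) :
    j * (1 - p) * steinSol n p k j
      = binCDF n p (min j k) * (1 - binCDF n p (max j k)) / binPMF n p j := by
  have hb := (binPMF_pos h0 h1 hj).ne'
  have hq : 1 - p ≠ 0 := by linarith
  -- At `j = 0` the solution is a division by zero, but its coefficient vanishes, as does the right
  -- side.
  rcases Nat.eq_zero_or_pos j with rfl | hj0
  · simp [binCDF_zero]
  have : (j : ℝ) ≠ 0 := by positivity
  unfold steinSol
  field_simp

lemma mul_steinSol_succ (h0 : 0 < p) (h1 : p < 1) {k : ℕ} (hk : k ≤ n + 1) {j : ℕ} (hj : j ≤ n) :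
    ((n : ℝ) - j) * p * steinSol n p k (j + 1)
      = binCDF n p (min (j + 1) k) * (1 - binCDF n p (max (j + 1) k)) / binPMF n p j := by
  rcases hj.eq_or_lt with rfl | hj'
  · rw [max_eq_left hk, binCDF_self_succ]; simp
  have hb := (binPMF_pos h0 h1 hj).ne'
  have hb' := (binPMF_pos h0 h1 (j := j + 1) hj').ne'
  have e := binPMF_succ_rec n p hj
  have hjn : (n : ℝ) - j ≠ 0 := by
    have : (j : ℝ) < n := by exact_mod_cast hj'
    linarith
  unfold steinSol
  push_cast
  rw [← e]
  field_simp

lemma stein_equation (h0 : 0 < p) (h1 : p < 1) {k : ℕ} (hk : k ≤ n + 1) {j : ℕ} (hj : j ≤ n) :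
    ((n : ℝ) - j) * p * steinSol n p k (j + 1) - j * (1 - p) * steinSol n p k j
      = below k j - binCDF n p k := by
  have hb := (binPMF_pos h0 h1 hj).ne'
  rw [mul_steinSol_succ h0 h1 hk hj, mul_steinSol h0 h1 k hj, below]
  split_ifs with h
  · rw [min_eq_left h, max_eq_right (Nat.succ_le_of_lt h), min_eq_left h.le, max_eq_right h.le,
      binCDF_succ]
    field_simp; ring
  · rw [min_eq_right (by lia), max_eq_left (by lia), min_eq_right (by lia), max_eq_left (by lia),
      binCDF_succ]
    field_simp; ring

/-- By monotonicity on each side of `k` the sign of the increment is known. It is largest for the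
`k` nearest to `j`, so `binCDF n p k` may be replaced by the value at `j + 1` (if `j < k`) or at `j`
(if `k ≤ j`). -/
lemma abs_steinSol_diff_le (h0 : 0 < p) (h1 : p < 1) {k : ℕ} (hk : k ≤ n + 1) {j : ℕ}
    (hj0 : 0 < j) (hj : j < n) :
    |steinSol n p k (j + 1) - steinSol n p k j| ≤ 1 / (n * p * (1 - p)) := by
  refine le_trans ?_ (binTail_add_binCDF_le h0 h1 hj0 hj)
  have hb := binPMF_pos h0 h1 hj.le
  have hq : 0 < 1 - p := by linarith
  have hjn : (0 : ℝ) < (n : ℝ) - j := by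
    have : (j : ℝ) < n := by exact_mod_cast hj
    linarith
  have hj0' : (0 : ℝ) < j := by exact_mod_cast hj0
  set x := ((n : ℝ) - j) * p with hx
  set y := (j : ℝ) * (1 - p) with hy
  have hx0 : 0 < x := by positivity
  have hy0 : 0 < y := by positivity
  have s1 := mul_steinSol_succ h0 h1 hk hj.le
  have s0 := mul_steinSol h0 h1 k hj.le
  have m1 := binCDF_ratio_mono h0.le h1.le hj.le
  have m2 := binTail_ratio_anti h0.le h1.le hj.le
  rw [← hx] at s1 m1 m2
  rw [← hy] at s0 m1 m2
  have s1' : steinSol n p k (j + 1)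
      = binCDF n p (min (j + 1) k) * (1 - binCDF n p (max (j + 1) k)) / (binPMF n p j * x) := by
    rw [← div_div, ← s1]; field_simp
  have s0' : steinSol n p k j
      = binCDF n p (min j k) * (1 - binCDF n p (max j k)) / (binPMF n p j * y) := by
    rw [← div_div, ← s0]; field_simp
  rw [s1', s0']
  have hB := binCDF_nonneg (n := n) h0.le h1.le j
  have hT : 0 ≤ 1 - binCDF n p (j + 1) := by
    linarith [binCDF_le_one (n := n) h0.le h1.le (k := j + 1) (by lia)]
  have hBs := binCDF_succ n p j
  set b := binPMF n p j
  set B := binCDF n p j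
  set B' := binCDF n p (j + 1)
  set Bk := binCDF n p k with hBk
  have hsum : (1 - B') / x + B / y = ((1 - B') * y + B * x) * b / (b * x * y) := by
    field_simp
  rcases lt_or_ge j k with h | h
  · have hkk : B' ≤ Bk := binCDF_mono h0.le h1.le (Nat.succ_le_of_lt h)
    have hk1 : Bk ≤ 1 := binCDF_le_one h0.le h1.le hk
    rw [min_eq_left (Nat.succ_le_of_lt h), max_eq_right (Nat.succ_le_of_lt h), min_eq_left h.le,
      max_eq_right h.le]
    have e : B' * (1 - Bk) / (b * x) - B * (1 - Bk) / (b * y)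
        = (1 - Bk) * (B' * y - B * x) / (b * x * y) := by field_simp
    rw [e, hsum, abs_of_nonneg (div_nonneg (mul_nonneg (by linarith) (by linarith)) (by positivity))]
    refine div_le_div_of_nonneg_right ?_ (by positivity)
    have t1 : (1 - Bk) * (B' * y - B * x) ≤ (1 - B') * (B' * y - B * x) :=
      mul_le_mul_of_nonneg_right (by linarith) (by linarith)
    refine t1.trans ?_
    have t2 := mul_le_mul_of_nonneg_left m2 hB
    rw [hBs] at t2 ⊢
    nlinarith
  · have hkk : Bk ≤ B := binCDF_mono h0.le h1.le h
    have hk0 : 0 ≤ Bk := binCDF_nonneg h0.le h1.le k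
    rw [min_eq_right (by lia), max_eq_left (by lia), min_eq_right (by lia), max_eq_left (by lia)]
    have e : Bk * (1 - B') / (b * x) - Bk * (1 - B) / (b * y)
        = -(Bk * ((1 - B) * x - (1 - B') * y) / (b * x * y)) := by field_simp; ring
    rw [e, hsum, abs_neg,
      abs_of_nonneg (div_nonneg (mul_nonneg (by linarith) (by linarith)) (by positivity))]
    refine div_le_div_of_nonneg_right ?_ (by positivity)
    have t1 : Bk * ((1 - B) * x - (1 - B') * y) ≤ B * ((1 - B) * x - (1 - B') * y) :=
      mul_le_mul_of_nonneg_right (by linarith) (by linarith)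
    refine t1.trans ?_
    have t2 := mul_le_mul_of_nonneg_left m1 hT
    rw [hBs] at t2 ⊢
    nlinarith

end bounds

/-! ### Poisson-binomial against binomial. -/

section comparison

variable {ι : Type*} [Fintype ι] [DecidableEq ι]

lemma X_mul_derivative_bernProd (p : ι → ℝ) :
    X * derivative (bernProd univ p) = ∑ i, p i • (X * bernProd (univ.erase i) p) := by
  rw [bernProd, derivative_prod_finset, mul_sum]
  refine sum_congr rfl fun i _ => ?_
  rw [← bernProd]
  simp [smul_eq_C_mul]; ring

lemma coeffSum_natCast_mul (f : ℕ → ℝ) (P : ℝ[X]) :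
    coeffSum (fun j => j * f j) P = coeffSum f (X * derivative P) := by
  induction P using Polynomial.induction_on' with
  | add P Q hP hQ => rw [map_add, derivative_add, mul_add, map_add, hP, hQ]
  | monomial n a =>
    rw [derivative_monomial, X_mul_monomial, coeffSum_monomial, coeffSum_monomial]
    cases n with
    | zero => simp
    | succ n => simp; ring

lemma coeffSum_natCast_mul_bernProd (f : ℕ → ℝ) (p : ι → ℝ) :
    coeffSum (fun j => j * f j) (bernProd univ p)
      = ∑ i, p i * coeffSum (fun j => f (j + 1)) (bernProd (univ.erase i) p) := by
  rw [coeffSum_natCast_mul, X_mul_derivative_bernProd, map_sum]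
  simp only [map_smul, smul_eq_mul, coeffSum_X_mul]

lemma coeffSum_card_sub_mul_bernProd (f : ℕ → ℝ) (p : ι → ℝ) :
    coeffSum (fun j => (Fintype.card ι - j) * f j) (bernProd univ p)
      = ∑ i, (1 - p i) * coeffSum f (bernProd (univ.erase i) p) := by
  have e : coeffSum (fun j => ((Fintype.card ι : ℝ) - j) * f j) (bernProd univ p)
      = Fintype.card ι * coeffSum f (bernProd univ p)
        - ∑ i, p i * coeffSum (fun j => f (j + 1)) (bernProd (univ.erase i) p) := by
    rw [← coeffSum_natCast_mul_bernProd, ← coeffSum_mul_left, ← coeffSum_sub]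
    simp only [sub_mul]
  have e2 : (Fintype.card ι : ℝ) * coeffSum f (bernProd univ p)
      = ∑ i : ι, coeffSum f (bernProd univ p) := by simp
  rw [e, e2, ← sum_sub_distrib]
  refine sum_congr rfl fun i _ => ?_
  have e3 : bernProd univ p
      = (1 - p i) • bernProd (univ.erase i) p + p i • (X * bernProd (univ.erase i) p) := by
    rw [bernProd, ← mul_prod_erase univ _ (mem_univ i), ← bernProd, smul_eq_C_mul, smul_eq_C_mul]
    ring
  rw [e3, map_add, map_smul, map_smul, coeffSum_X_mul, smul_eq_mul, smul_eq_mul]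
  ring

/-- Ehm's binomial approximation bound, for distribution functions. -/
theorem abs_coeffSum_below_sub_le_div {p : ι → ℝ} {a : ℝ}
    (hp : ∀ i, p i ∈ Set.Icc (0 : ℝ) 1) (h0 : 0 < a) (h1 : a < 1)
    (hsum : ∑ i, (p i - a) = 0) {k : ℕ} (hk : k ≤ Fintype.card ι + 1) :
    |coeffSum (below k) (bernProd univ p) - binCDF (Fintype.card ι) a k|
      ≤ 1 / (Fintype.card ι * a * (1 - a)) * ∑ i, (p i - a) ^ 2 := by
  set n := Fintype.card ι with hn
  set f := steinSol n a k
  have hdeg : (bernProd univ p).natDegree ≤ n := bernProd_natDegree_le _ _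
  have e1 : coeffSum (below k) (bernProd univ p) - binCDF n a k
      = coeffSum (fun j => a * (((n : ℝ) - j) * f (j + 1)) - (1 - a) * (j * f j))
        (bernProd univ p) := by
    have : binCDF n a k = coeffSum (fun _ => binCDF n a k) (bernProd univ p) := by
      rw [coeffSum_const, bernProd_eval_one, mul_one]
    rw [this, ← coeffSum_sub]
    refine coeffSum_congr hdeg fun j hj => ?_
    rw [← stein_equation h0 h1 hk hj]
    ring
  -- The Stein equation in expectation: trial `i` contributes with weight `a (1 - p i) - (1 - a) p i
  -- = -(p i - a)`.
  have e2 : coeffSum (below k) (bernProd univ p) - binCDF n a k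
      = -∑ i, (p i - a) * coeffSum (fun j => f (j + 1)) (bernProd (univ.erase i) p) := by
    rw [e1, coeffSum_sub, coeffSum_mul_left, coeffSum_mul_left, coeffSum_natCast_mul_bernProd, hn,
      coeffSum_card_sub_mul_bernProd (fun j => f (j + 1)), mul_sum, mul_sum, ← sum_sub_distrib,
      ← sum_neg_distrib]
    exact sum_congr rfl fun i _ => by ring
  have hpa : p = fun i => a + 1 * (p i - a) := by ext i; ring
  have key := abs_sum_mul_le_of_pairs (a := a) (c := 1 / (n * a * (1 - a))) zero_le_one hsum
      (coeffSum (fun j => f (j + 1))) (by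
    intro i j hij
    rw [← hpa, coeffSum_X_sub_one_mul]
    -- With two trials removed, only increments of `f` at the interior points `l + 1`, `l ≤ n - 2`,
    -- occur.
    have hc : #((univ.erase i).erase j) + 2 = n := by
      rw [card_erase_of_mem (by simp [hij.symm]), card_erase_of_mem (mem_univ _), card_univ, ← hn]
      have : 1 < n := Fintype.one_lt_card_iff.2 ⟨i, j, hij⟩
      lia
    exact abs_coeffSum_le (bernProd_natDegree_le _ _)
      (bernProd_coeff_nonneg _ (fun i => (hp i).1) fun i => (hp i).2) (bernProd_eval_one _ _)
      fun l hl => abs_steinSol_diff_le h0 h1 hk (by lia) (by lia))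
  rw [← hpa, mul_one] at key
  rw [e2, abs_neg]
  exact key

/-- The weight in front of the sum of squared deviations in the binomial approximation. -/
noncomputable def approxWeight (n : ℕ) (a : ℝ) : ℝ := 1 / max 2 (n * (a * (1 - a)))

theorem abs_coeffSum_below_sub_le {p : ι → ℝ} {a : ℝ}
    (hp : ∀ i, p i ∈ Set.Icc (0 : ℝ) 1) (ha : a ∈ Set.Icc (0 : ℝ) 1)
    (hsum : ∑ i, (p i - a) = 0) {k : ℕ} (hk : k ≤ Fintype.card ι + 1) :
    |coeffSum (below k) (bernProd univ p) - binCDF (Fintype.card ι) a k|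
      ≤ approxWeight (Fintype.card ι) a * ∑ i, (p i - a) ^ 2 := by
  rcases le_total (Fintype.card ι * (a * (1 - a))) 2 with h | h
  · rw [approxWeight, max_eq_left h, ← coeffSum_below_bernProd_const a hk]
    exact abs_coeffSum_below_sub_le_half hp ha hsum k
  · rw [approxWeight, max_eq_right h, ← mul_assoc]
    refine abs_coeffSum_below_sub_le_div hp (ha.1.lt_of_ne ?_) (ha.2.lt_of_ne ?_) hsum hk
    · rintro rfl; norm_num at h
    · rintro rfl; norm_num at h

end comparison

end SplitConformal

namespace SplitConformal
open Finset

/-! ### Monotone integrands and the Kolmogorov–Smirnov distance. -/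

section ks

variable {μ ν : Measure ℝ} [IsProbabilityMeasure μ] [IsProbabilityMeasure ν]

lemma ksDist_nonneg (μ ν : Measure ℝ) : 0 ≤ ksDist μ ν := Real.iSup_nonneg fun _ => abs_nonneg _

lemma abs_measureReal_Iic_sub_le (b : ℝ) :
    |μ.real (Set.Iic b) - ν.real (Set.Iic b)| ≤ ksDist μ ν := by
  refine le_ciSup (f := fun b => |μ.real (Set.Iic b) - ν.real (Set.Iic b)|) ⟨1, ?_⟩ b
  rintro _ ⟨x, rfl⟩
  have h1 : μ.real (Set.Iic x) ≤ 1 := measureReal_le_one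
  have h2 : ν.real (Set.Iic x) ≤ 1 := measureReal_le_one
  have h3 : 0 ≤ μ.real (Set.Iic x) := measureReal_nonneg
  have h4 : 0 ≤ ν.real (Set.Iic x) := measureReal_nonneg
  exact abs_le.2 ⟨by linarith, by linarith⟩

lemma abs_measureReal_Iio_sub_le (b : ℝ) :
    |μ.real (Set.Iio b) - ν.real (Set.Iio b)| ≤ ksDist μ ν := by
  obtain ⟨u, hu, hub, hlim⟩ := exists_seq_strictMono_tendsto b
  have hU : ⋃ n, Set.Iic (u n) = Set.Iio b := iUnion_Iic_eq_Iio_of_lt_of_tendsto hub hlim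
  have key : ∀ ρ : Measure ℝ, IsProbabilityMeasure ρ →
      Filter.Tendsto (fun n => ρ.real (Set.Iic (u n))) Filter.atTop (nhds (ρ.real (Set.Iio b))) := by
    intro ρ _
    rw [← hU]
    exact (ENNReal.tendsto_toReal (measure_ne_top _ _)).comp
      (tendsto_measure_iUnion_atTop fun i j h => Set.Iic_subset_Iic.2 (hu.monotone h))
  exact le_of_tendsto ((key μ inferInstance).sub (key ν inferInstance)).abs
    (Filter.Eventually.of_forall fun n => abs_measureReal_Iic_sub_le _)

/-- A lower set of the line is empty, everything, or an open or closed half-line. -/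
lemma abs_measureReal_isLowerSet_sub_le {A : Set ℝ} (hA : IsLowerSet A) :
    |μ.real A - ν.real A| ≤ ksDist μ ν := by
  rcases A.eq_empty_or_nonempty with rfl | hne
  · simpa using ksDist_nonneg μ ν
  by_cases hbd : BddAbove A
  · have hlub := isLUB_csSup hne hbd
    by_cases hmem : sSup A ∈ A
    · have : A = Set.Iic (sSup A) :=
        Set.Subset.antisymm (fun x hx => hlub.1 hx) fun x hx => hA hx hmem
      rw [this]; exact abs_measureReal_Iic_sub_le _
    · have : A = Set.Iio (sSup A) := by
        refine Set.Subset.antisymm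
          (fun x hx => lt_of_le_of_ne (hlub.1 hx) fun h => hmem (h ▸ hx)) fun x hx => ?_
        obtain ⟨y, hy, hxy⟩ := exists_lt_of_lt_csSup hne hx
        exact hA hxy.le hy
      rw [this]; exact abs_measureReal_Iio_sub_le _
  · have : A = Set.univ := by
      refine Set.eq_univ_of_forall fun x => ?_
      obtain ⟨y, hy, hxy⟩ := not_bddAbove_iff.1 hbd x
      exact hA hxy.le hy
    simpa [this] using ksDist_nonneg μ ν

lemma integrable_of_antitone_bounded {g : ℝ → ℝ} (hg : Antitone g) {c : ℝ} (h0 : ∀ x, 0 ≤ g x)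
    (hc : ∀ x, g x ≤ c) : Integrable g μ :=
  Integrable.of_bound hg.measurable.aestronglyMeasurable c
    (Filter.Eventually.of_forall fun x => by rw [Real.norm_of_nonneg (h0 x)]; exact hc x)

/-- Integrals of a bounded antitone function differ by at most its range times the
Kolmogorov–Smirnov distance. -/
theorem abs_integral_antitone_sub_le {g : ℝ → ℝ} (hg : Antitone g) {c : ℝ} (h0 : ∀ x, 0 ≤ g x)
    (hc : ∀ x, g x ≤ c) : |∫ x, g x ∂μ - ∫ x, g x ∂ν| ≤ c * ksDist μ ν := by
  have hc0 : 0 ≤ c := (h0 0).trans (hc 0)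
  -- Layer-cake formula; the superlevel sets of an antitone function are lower sets.
  have lc : ∀ ρ : Measure ℝ, IsProbabilityMeasure ρ →
      ∫ x, g x ∂ρ = ∫ t in (0 : ℝ)..c, ρ.real {a | t ≤ g a} := by
    intro ρ _
    rw [intervalIntegral.integral_of_le hc0]
    exact (integrable_of_antitone_bounded hg h0 hc).integral_eq_integral_Ioc_meas_le
      (Filter.Eventually.of_forall h0) (Filter.Eventually.of_forall hc)
  have ii : ∀ ρ : Measure ℝ, IsProbabilityMeasure ρ →
      IntervalIntegrable (fun t => ρ.real {a | t ≤ g a}) volume 0 c := by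
    intro ρ _
    refine Antitone.intervalIntegrable fun s t hst => ?_
    exact measureReal_mono fun a (ha : t ≤ g a) => hst.trans ha
  rw [lc μ inferInstance, lc ν inferInstance,
    ← intervalIntegral.integral_sub (ii μ inferInstance) (ii ν inferInstance), ← Real.norm_eq_abs]
  have := intervalIntegral.norm_integral_le_of_norm_le_const (a := 0) (b := c)
    (f := fun t => μ.real {a | t ≤ g a} - ν.real {a | t ≤ g a}) (C := ksDist μ ν) fun t _ => by
      rw [Real.norm_eq_abs]
      exact abs_measureReal_isLowerSet_sub_le fun a b hab (ha : t ≤ g a) => ha.trans (hg hab)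
  rwa [sub_zero, abs_of_nonneg hc0, mul_comm] at this

theorem abs_integral_monotone_sub_le {g : ℝ → ℝ} (hg : Monotone g) {c : ℝ} (h0 : ∀ x, 0 ≤ g x)
    (hc : ∀ x, g x ≤ c) : |∫ x, g x ∂μ - ∫ x, g x ∂ν| ≤ c * ksDist μ ν := by
  have hanti : Antitone fun x => c - g x := fun x y h => sub_le_sub_left (hg h) c
  have h0' : ∀ x, 0 ≤ c - g x := fun x => by linarith [hc x]
  have hc' : ∀ x, c - g x ≤ c := fun x => by linarith [h0 x]
  have e : ∀ ρ : Measure ℝ, IsProbabilityMeasure ρ → ∫ x, g x ∂ρ = c - ∫ x, (c - g x) ∂ρ := by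
    intro ρ _
    have hi := integrable_of_antitone_bounded (μ := ρ) hanti h0' hc'
    have : ∫ x, (c - (c - g x)) ∂ρ = c - ∫ x, (c - g x) ∂ρ := by
      rw [integral_sub (integrable_const _) hi]; simp
    simpa using this
  have := abs_integral_antitone_sub_le (μ := μ) (ν := ν) hanti h0' hc'
  rw [e μ inferInstance, e ν inferInstance, sub_sub_sub_cancel_left, abs_sub_comm]
  exact this

end ks

instance : IsProbabilityMeasure uniform01 := ⟨by simp [uniform01]⟩

lemma integral_uniform01 (g : ℝ → ℝ) : ∫ x, g x ∂uniform01 = ∫ x in (0 : ℝ)..1, g x := by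
  rw [uniform01, intervalIntegral.integral_of_le zero_le_one, integral_Ioc_eq_integral_Ioo]

/-! ### The binomial distribution function as a function of its parameter. -/

section binomial

lemma binPMF_eq_eval (n j : ℕ) (p : ℝ) : binPMF n p j = (bernsteinPolynomial ℝ n j).eval p := by
  simp [bernsteinPolynomial, binPMF]

/-- The derivatives of the Bernstein polynomials telescope. Monotonicity in `p` and the integrals
over `[0, 1]` both follow. -/
lemma hasDerivAt_binCDF (n k : ℕ) (p : ℝ) :
    HasDerivAt (fun p => binCDF (n + 1) p (k + 1)) (-((n + 1) * binPMF n p k)) p := by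
  induction k with
  | zero =>
    have := (bernsteinPolynomial ℝ (n + 1) 0).hasDerivAt p
    rw [bernsteinPolynomial.derivative_zero] at this
    simp only [binCDF_succ, binCDF_zero, zero_add, binPMF_eq_eval]
    refine this.congr_deriv ?_
    simp; ring
  | succ k ih =>
    have := (bernsteinPolynomial ℝ (n + 1) (k + 1)).hasDerivAt p
    rw [bernsteinPolynomial.derivative_succ] at this
    simp only [binCDF_succ _ _ (k + 1)]
    simp only [binPMF_eq_eval] at ih ⊢
    refine (ih.add this).congr_deriv ?_
    simp; ring

lemma binCDF_antitoneOn {n : ℕ} (hn : 1 ≤ n) (k : ℕ) :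
    AntitoneOn (fun p => binCDF n p k) (Set.Icc 0 1) := by
  obtain ⟨n, rfl⟩ : ∃ l, n = l + 1 := ⟨n - 1, by lia⟩
  cases k with
  | zero => simp only [binCDF_zero]; exact antitoneOn_const
  | succ k =>
    refine antitoneOn_of_hasDerivWithinAt_nonpos (convex_Icc _ _)
      (fun p _ => (hasDerivAt_binCDF n k p).continuousAt.continuousWithinAt)
      (fun p _ => (hasDerivAt_binCDF n k p).hasDerivWithinAt) fun p hp => ?_
    rw [interior_Icc] at hp
    have := binPMF_nonneg (n := n) hp.1.le hp.2.le k
    have : 0 ≤ ((n : ℝ) + 1) * binPMF n p k := by positivity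
    linarith

lemma continuous_binPMF (n j : ℕ) : Continuous fun p => binPMF n p j := by
  unfold binPMF; fun_prop

lemma continuous_binCDF (n k : ℕ) : Continuous fun p => binCDF n p k :=
  continuous_finsetSum _ fun j _ => continuous_binPMF n j

lemma binCDF_at_zero (n k : ℕ) : binCDF n 0 (k + 1) = 1 := by
  rw [binCDF, sum_range_succ']
  simp [binPMF]

lemma binCDF_at_one {n k : ℕ} (hk : k ≤ n) : binCDF n 1 k = 0 := by
  refine sum_eq_zero fun j hj => ?_
  have : n - j ≠ 0 := by have := mem_range.1 hj; lia
  simp [binPMF, this]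

lemma integral_binPMF {n j : ℕ} (hj : j ≤ n) :
    ∫ p in (0 : ℝ)..1, binPMF n p j = 1 / (n + 1) := by
  have h := intervalIntegral.integral_eq_sub_of_hasDerivAt (a := 0) (b := 1)
    (fun p _ => hasDerivAt_binCDF n j p)
    (((continuous_binPMF n j).const_mul _).neg.intervalIntegrable _ _)
  rw [binCDF_at_zero, binCDF_at_one (by lia), intervalIntegral.integral_neg,
    intervalIntegral.integral_const_mul] at h
  field_simp
  linarith

lemma integral_binCDF {n k : ℕ} (hk : k ≤ n + 1) :
    ∫ p in (0 : ℝ)..1, binCDF n p k = k / (n + 1) := by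
  simp only [binCDF]
  rw [intervalIntegral.integral_finsetSum fun j _ => (continuous_binPMF n j).intervalIntegrable _ _,
    sum_congr rfl fun j hj => integral_binPMF (n := n) (j := j) (by have := mem_range.1 hj; lia)]
  simp [div_eq_mul_inv]

/-- The binomial distribution function with its parameter clamped to `[0, 1]`. -/
noncomputable def clampedBinCDF (n k : ℕ) (x : ℝ) : ℝ :=
  binCDF n (Set.projIcc (0 : ℝ) 1 zero_le_one x) k

lemma clampedBinCDF_of_mem {n k : ℕ} {x : ℝ} (hx : x ∈ Set.Icc (0 : ℝ) 1) :
    clampedBinCDF n k x = binCDF n x k := by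
  rw [clampedBinCDF, Set.projIcc_of_mem _ hx]

lemma abs_integral_clampedBinCDF_sub_le {μ : Measure ℝ} [IsProbabilityMeasure μ] {n k : ℕ}
    (hn : 1 ≤ n) (hk : k ≤ n + 1) :
    |∫ x, clampedBinCDF n k x ∂μ - k / (n + 1)| ≤ ksDist μ uniform01 := by
  -- Clamping extends the monotonicity from `[0, 1]` to the whole line, where the Kolmogorov–Smirnov
  -- estimate needs it.
  have hanti : Antitone (clampedBinCDF n k) := fun x y h =>
    binCDF_antitoneOn hn k (Subtype.prop _) (Subtype.prop _)
      (Subtype.coe_le_coe.2 (Set.monotone_projIcc _ h))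
  have := abs_integral_antitone_sub_le (μ := μ) (ν := uniform01) (c := 1) hanti
    (fun x => binCDF_nonneg (Subtype.prop (Set.projIcc (0 : ℝ) 1 zero_le_one x)).1
      (Subtype.prop (Set.projIcc (0 : ℝ) 1 zero_le_one x)).2 _)
    (fun x => binCDF_le_one (Subtype.prop (Set.projIcc (0 : ℝ) 1 zero_le_one x)).1
      (Subtype.prop (Set.projIcc (0 : ℝ) 1 zero_le_one x)).2 hk)
  rw [integral_uniform01, one_mul] at this
  rwa [intervalIntegral.integral_congr (g := fun p => binCDF n p k), integral_binCDF hk] at this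
  intro x hx
  rw [Set.uIcc_of_le zero_le_one] at hx
  exact clampedBinCDF_of_mem hx

end binomial

/-! ### The integral of the approximation weight. -/

section weight

lemma approxWeight_nonneg (n : ℕ) (x : ℝ) : 0 ≤ approxWeight n x := by
  unfold approxWeight; positivity

lemma approxWeight_le_half (n : ℕ) (x : ℝ) : approxWeight n x ≤ 1 / 2 := by
  unfold approxWeight
  exact one_div_le_one_div_of_le (by norm_num) (le_max_left _ _)

lemma continuous_approxWeight (n : ℕ) : Continuous (approxWeight n) := by
  unfold approxWeight
  refine Continuous.div continuous_const (by fun_prop) fun x => ?_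
  positivity

lemma approxWeight_anti {n : ℕ} {x y : ℝ} (h : x * (1 - x) ≤ y * (1 - y)) :
    approxWeight n y ≤ approxWeight n x := by
  unfold approxWeight
  gcongr

/-- The weight decreases up to `1/2`, increases afterwards and lies in `[0, 1/2]`. Each monotone
piece costs half the distance. -/
lemma integral_approxWeight_le_add {μ : Measure ℝ} [IsProbabilityMeasure μ] (n : ℕ) :
    ∫ x, approxWeight n x ∂μ ≤ (∫ x in (0 : ℝ)..1, approxWeight n x) + ksDist μ uniform01 := by
  set g₁ : ℝ → ℝ := fun x => approxWeight n (min x (1 / 2))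
  set g₂ : ℝ → ℝ := fun x => approxWeight n (max x (1 / 2))
  have h₁ : Antitone g₁ := fun x y h => approxWeight_anti (by
    have a1 : min x (1 / 2) ≤ min y (1 / 2) := min_le_min_right _ h
    have a2 : min y (1 / 2) ≤ 1 / 2 := min_le_right _ _
    nlinarith)
  have h₂ : Monotone g₂ := fun x y h => approxWeight_anti (by
    have a1 : max x (1 / 2) ≤ max y (1 / 2) := max_le_max_right _ h
    have a2 : 1 / 2 ≤ max x (1 / 2) := le_max_right _ _
    nlinarith)
  have e : ∀ x, approxWeight n x = g₁ x + g₂ x - approxWeight n (1 / 2) := by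
    intro x
    rcases le_total x (1 / 2) with h | h
    · simp only [g₁, g₂, min_eq_left h, max_eq_right h]; ring
    · simp only [g₁, g₂, min_eq_right h, max_eq_left h]; ring
  have b₁ := abs_integral_antitone_sub_le (μ := μ) (ν := uniform01) h₁
    (fun x => approxWeight_nonneg n _) (fun x => approxWeight_le_half n _)
  have b₂ := abs_integral_monotone_sub_le (μ := μ) (ν := uniform01) h₂
    (fun x => approxWeight_nonneg n _) (fun x => approxWeight_le_half n _)
  have ei : ∀ ρ : Measure ℝ, IsProbabilityMeasure ρ → ∫ x, approxWeight n x ∂ρ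
      = ∫ x, g₁ x ∂ρ + ∫ x, g₂ x ∂ρ - approxWeight n (1 / 2) := by
    intro ρ _
    have hb : ∀ y, ‖approxWeight n y‖ ≤ 1 / 2 := fun y => by
      rw [Real.norm_of_nonneg (approxWeight_nonneg n y)]; exact approxWeight_le_half n y
    have i₁ : Integrable g₁ ρ := Integrable.of_bound h₁.measurable.aestronglyMeasurable (1 / 2)
      (Filter.Eventually.of_forall fun x => hb _)
    have i₂ : Integrable g₂ ρ := Integrable.of_bound h₂.measurable.aestronglyMeasurable (1 / 2)
      (Filter.Eventually.of_forall fun x => hb _)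
    rw [integral_congr_ae (Filter.Eventually.of_forall e),
      integral_sub (f := fun x => g₁ x + g₂ x) (i₁.add i₂) (integrable_const _), integral_add i₁ i₂]
    simp
  rw [← integral_uniform01, ei μ inferInstance, ei uniform01 inferInstance]
  linarith [(abs_le.1 b₁).2, (abs_le.1 b₂).2]

/-- `I_n` is the integral of `min 1 (1/(n x (1 - x)))`, which dominates the weight. For `n > 4` the
minimum switches at the roots `(1 ± r)/2` of `n x (1 - x) = 1`. -/
lemma integral_approxWeight_le_IConst (n : ℕ) :
    ∫ x in (0 : ℝ)..1, approxWeight n x ≤ IConst n := by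
  have ii : ∀ a b, IntervalIntegrable (approxWeight n) volume a b := fun a b =>
    (continuous_approxWeight n).intervalIntegrable a b
  have hle : ∀ x, approxWeight n x ≤ 1 := fun x => (approxWeight_le_half n x).trans (by norm_num)
  have hconst : ∀ a b : ℝ, a ≤ b → ∫ x in a..b, approxWeight n x ≤ b - a := by
    intro a b hab
    have := intervalIntegral.integral_mono_on hab (ii a b)
      (continuous_const.intervalIntegrable a b) fun x _ => hle x
    simpa using this
  unfold IConst
  split_ifs with h
  · simpa using hconst 0 1 zero_le_one
  have hn : (4 : ℝ) < n := by exact_mod_cast not_le.1 h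
  set r := √(1 - 4 / (n : ℝ)) with hr
  have hr1 : r < 1 := by
    rw [hr, Real.sqrt_lt' one_pos]
    have : 0 < 4 / (n : ℝ) := by positivity
    linarith
  have hr0 : 0 ≤ r := Real.sqrt_nonneg _
  have hmid : ∫ x in ((1 - r) / 2)..((1 + r) / 2), approxWeight n x
      ≤ 2 / n * Real.log ((1 + r) / (1 - r)) := by
    have hpos : ∀ x ∈ Set.Icc ((1 - r) / 2) ((1 + r) / 2), 0 < x ∧ 0 < 1 - x := fun x hx =>
      ⟨by linarith [hx.1], by linarith [hx.2]⟩
    have hd : ∀ x ∈ Set.uIcc ((1 - r) / 2) ((1 + r) / 2),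
        HasDerivAt (fun x => 1 / n * (Real.log x - Real.log (1 - x))) (1 / (n * (x * (1 - x)))) x := by
      intro x hx
      rw [Set.uIcc_of_le (by linarith)] at hx
      obtain ⟨hx0, hx1⟩ := hpos x hx
      have d1 := Real.hasDerivAt_log hx0.ne'
      have d2 := ((hasDerivAt_id x).const_sub 1).log hx1.ne'
      refine ((d1.sub d2).const_mul (1 / (n : ℝ))).congr_deriv ?_
      have : x ≠ 0 := hx0.ne'
      have h2 : 1 - x ≠ 0 := hx1.ne'
      simp only [id]
      field_simp
      ring
    have hcont : IntervalIntegrable (fun x : ℝ => 1 / (n * (x * (1 - x)))) volume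
        ((1 - r) / 2) ((1 + r) / 2) := by
      refine ContinuousOn.intervalIntegrable ?_
      rw [Set.uIcc_of_le (by linarith)]
      refine ContinuousOn.div (by fun_prop) (by fun_prop) fun x hx => ?_
      obtain ⟨hx0, hx1⟩ := hpos x hx
      positivity
    refine (intervalIntegral.integral_mono_on (by linarith) (ii _ _) hcont fun x hx => ?_).trans
      (le_of_eq ?_)
    · obtain ⟨hx0, hx1⟩ := hpos x hx
      exact one_div_le_one_div_of_le (by positivity) (le_max_right _ _)
    · rw [intervalIntegral.integral_eq_sub_of_hasDerivAt hd hcont]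
      have e1 : 1 - (1 + r) / 2 = (1 - r) / 2 := by ring
      have e2 : 1 - (1 - r) / 2 = (1 + r) / 2 := by ring
      have p1 : (1 - r) ≠ 0 := by linarith
      have p2 : (1 + r) ≠ 0 := by linarith
      rw [e1, e2, Real.log_div p2 p1, Real.log_div p2 two_ne_zero, Real.log_div p1 two_ne_zero]
      ring
  rw [← intervalIntegral.integral_add_adjacent_intervals (ii 0 ((1 - r) / 2)) (ii _ 1),
    ← intervalIntegral.integral_add_adjacent_intervals (ii _ ((1 + r) / 2)) (ii _ 1)]
  linarith [hconst 0 ((1 - r) / 2) (by linarith), hconst ((1 + r) / 2) 1 (by linarith)]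

end weight

/-! ### The integral of Chernoff's bound. -/

section tail

/-- Chernoff's bound for the probability that a sum of independent Bernoulli variables with mean
`c + y` is at most `c`. -/
noncomputable def chernoffTail (c : ℕ) (y : ℝ) : ℝ := (y / c + 1) ^ c * Real.exp (-y)

lemma continuous_chernoffTail (c : ℕ) : Continuous (chernoffTail c) := by
  unfold chernoffTail; fun_prop

lemma chernoffTail_nonneg (c : ℕ) {y : ℝ} (hy : 0 ≤ y) : 0 ≤ chernoffTail c y := by
  unfold chernoffTail; positivity

lemma chernoffTail_zero (c : ℕ) : chernoffTail c 0 = 1 := by simp [chernoffTail]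

/-- The function is the `c`-th power of `(1 + u) e^{-u}` at `u = y / c`, decreasing for `u ≥ 0`. For
`c = 0` it is just `e^{-y}`. -/
lemma chernoffTail_anti (c : ℕ) {x y : ℝ} (hx : 0 ≤ x) (hxy : x ≤ y) :
    chernoffTail c y ≤ chernoffTail c x := by
  rcases Nat.eq_zero_or_pos c with rfl | hc
  · simpa [chernoffTail] using hxy
  have hc' : (0 : ℝ) < c := by exact_mod_cast hc
  have e : ∀ z : ℝ, chernoffTail c z = ((z / c + 1) * Real.exp (-(z / c))) ^ c := by
    intro z
    rw [chernoffTail, mul_pow, ← Real.exp_nat_mul]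
    congr 2
    field_simp
  rw [e, e]
  have hu : 0 ≤ x / c := by positivity
  have hw : x / c ≤ y / c := by gcongr
  have hw0 : 0 ≤ y / c := hu.trans hw
  refine pow_le_pow_left₀ (by positivity) ?_ c
  have h1 := Real.add_one_le_exp (y / c - x / c)
  have h2 : y / c + 1 ≤ (x / c + 1) * Real.exp (y / c - x / c) := by nlinarith
  calc (y / c + 1) * Real.exp (-(y / c))
      ≤ (x / c + 1) * Real.exp (y / c - x / c) * Real.exp (-(y / c)) := by gcongr
    _ = (x / c + 1) * Real.exp (-(x / c)) := by
        rw [mul_assoc, ← Real.exp_add]; congr 2; ring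

lemma integrableOn_pow_mul_exp_neg (r : ℕ) :
    IntegrableOn (fun y : ℝ => y ^ r * Real.exp (-y)) (Set.Ioi 0) := by
  have := Real.GammaIntegral_convergent (s := r + 1) (by positivity)
  refine this.congr_fun (fun y _ => ?_) measurableSet_Ioi
  simp [Real.rpow_natCast, mul_comm]

lemma integral_pow_mul_exp_neg (r : ℕ) :
    ∫ y in Set.Ioi (0 : ℝ), y ^ r * Real.exp (-y) = r.factorial := by
  rw [← Real.Gamma_nat_eq_factorial, Real.Gamma_eq_integral (by positivity)]
  refine setIntegral_congr_fun measurableSet_Ioi fun y _ => ?_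
  simp [Real.rpow_natCast, mul_comm]

lemma chernoffTail_eq_sum (c : ℕ) (y : ℝ) : chernoffTail c y
    = ∑ r ∈ range (c + 1), (c.choose r / (c : ℝ) ^ r) * (y ^ r * Real.exp (-y)) := by
  rw [chernoffTail, add_pow, sum_mul]
  refine sum_congr rfl fun r _ => ?_
  rw [one_pow, div_pow]; ring

lemma integrableOn_chernoffTail (c : ℕ) : IntegrableOn (chernoffTail c) (Set.Ioi 0) := by
  simp only [funext (chernoffTail_eq_sum c)]
  exact integrable_finsetSum _ fun r _ => (integrableOn_pow_mul_exp_neg r).const_mul _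

/-- Expanding the power, the term of order `r` integrates to `c (c-1) ⋯ (c-r+1) / c^r`, at most `1 -
(r-1)/c` for `r ≥ 1`. -/
lemma integral_chernoffTail_le (c : ℕ) :
    ∫ y in Set.Ioi (0 : ℝ), chernoffTail c y ≤ ((c : ℝ) + 3) / 2 := by
  simp only [funext (chernoffTail_eq_sum c)]
  rw [integral_finsetSum _ fun r _ => (integrableOn_pow_mul_exp_neg r).const_mul _]
  simp only [integral_const_mul, integral_pow_mul_exp_neg]
  rw [sum_range_succ']
  have hb : ∀ r ∈ range c, ((c.choose (r + 1) : ℝ) / (c : ℝ) ^ (r + 1)) * ((r + 1).factorial : ℝ)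
      ≤ 1 - r / c := by
    intro r hr
    have hrc : r < c := mem_range.1 hr
    have hc : (0 : ℝ) < c := by exact_mod_cast (Nat.zero_le r).trans_lt hrc
    have h1 : (c.choose (r + 1) : ℝ) * ((r + 1).factorial : ℝ) = (c - r) * c.descFactorial r := by
      have := Nat.descFactorial_eq_factorial_mul_choose c (r + 1)
      rw [Nat.descFactorial_succ] at this
      rw [← Nat.cast_sub hrc.le, mul_comm]; exact_mod_cast this.symm
    have h2 : (c.descFactorial r : ℝ) ≤ (c : ℝ) ^ r := by
      exact_mod_cast Nat.descFactorial_le_pow c r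
    have h3 : (0 : ℝ) ≤ c - r := by
      have : (r : ℝ) < c := by exact_mod_cast hrc
      linarith
    rw [div_mul_eq_mul_div, h1, div_le_iff₀ (by positivity)]
    calc ((c : ℝ) - r) * c.descFactorial r ≤ (c - r) * (c : ℝ) ^ r := by gcongr
      _ = (1 - r / c) * (c : ℝ) ^ (r + 1) := by rw [pow_succ]; field_simp
  have hs : ∑ r ∈ range c, (1 - (r : ℝ) / c) ≤ (c + 1) / 2 := by
    rcases Nat.eq_zero_or_pos c with rfl | hc
    · norm_num
    have hc' : (c : ℝ) ≠ 0 := by positivity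
    have hg : (∑ r ∈ range c, (r : ℝ)) * 2 = c * (c - 1) := by
      have := Finset.sum_range_id_mul_two c
      rw [← Nat.cast_pred hc, ← Nat.cast_sum]; exact_mod_cast this
    rw [sum_sub_distrib, ← sum_div]
    simp only [sum_const, card_range, nsmul_eq_mul, mul_one]
    have : (∑ r ∈ range c, (r : ℝ)) / c = (c - 1) / 2 := by
      field_simp; linarith
    rw [this]; linarith
  have := sum_le_sum hb
  simp only [Nat.choose_zero_right, pow_zero, Nat.factorial_zero, Nat.cast_one, div_one, mul_one]
  linarith

/-- Chernoff's bound as a function of the mean, extended by `1` below `c`. -/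
noncomputable def chernoffBound (c : ℕ) (x : ℝ) : ℝ := chernoffTail c (max (x - c) 0)

lemma chernoffBound_nonneg (c : ℕ) (x : ℝ) : 0 ≤ chernoffBound c x :=
  chernoffTail_nonneg c (le_max_right _ _)

lemma chernoffBound_antitone (c : ℕ) : Antitone (chernoffBound c) := fun x y h =>
  chernoffTail_anti c (le_max_right _ _) (max_le_max_right _ (by linarith))

lemma chernoffBound_le_one (c : ℕ) (x : ℝ) : chernoffBound c x ≤ 1 := by
  rw [← chernoffTail_zero c]
  exact chernoffTail_anti c le_rfl (le_max_right _ _)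

/-- Means below `c` contribute at most `c`, those above at most `(c + 3)/2`. The total `3(c + 1)/2`
explains the `2/3` in the modified rank. -/
lemma integral_chernoffBound_le {c m : ℕ} (hm : 0 < m) (hc : c ≤ m) :
    ∫ p in (0 : ℝ)..1, chernoffBound c (m - m * p) ≤ 3 / 2 * (c + 1) / m := by
  have hm' : (0 : ℝ) < m := by exact_mod_cast hm
  have hcm : (c : ℝ) ≤ m := by exact_mod_cast hc
  have hcont : Continuous (chernoffBound c) := by
    unfold chernoffBound
    exact (continuous_chernoffTail c).comp (by fun_prop)
  have ii : ∀ a b, IntervalIntegrable (chernoffBound c) volume a b := fun a b =>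
    hcont.intervalIntegrable a b
  rw [intervalIntegral.integral_comp_sub_mul _ hm'.ne', mul_one, mul_zero, sub_self, sub_zero,
    ← intervalIntegral.integral_add_adjacent_intervals (ii 0 c) (ii c m), smul_eq_mul]
  have h1 : ∫ x in (0 : ℝ)..c, chernoffBound c x ≤ c := by
    have := intervalIntegral.integral_mono_on (by positivity) (ii 0 c)
      (continuous_const.intervalIntegrable _ _) fun x _ => chernoffBound_le_one c x
    simpa using this
  have h2 : ∫ x in (c : ℝ)..m, chernoffBound c x ≤ (c + 3) / 2 := by
    have e : ∫ x in (c : ℝ)..m, chernoffBound c x = ∫ x in (c : ℝ)..m, chernoffTail c (x - c) := by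
      refine intervalIntegral.integral_congr fun x hx => ?_
      rw [Set.uIcc_of_le hcm] at hx
      simp only [chernoffBound]
      rw [max_eq_left (by linarith [hx.1])]
    rw [e, intervalIntegral.integral_comp_sub_right, sub_self,
      intervalIntegral.integral_of_le (by linarith)]
    refine le_trans ?_ (integral_chernoffTail_le c)
    refine setIntegral_mono_set (integrableOn_chernoffTail c) ?_ (Set.Ioc_subset_Ioi_self).eventuallyLE
    filter_upwards [self_mem_ae_restrict measurableSet_Ioi] with y hy
    exact chernoffTail_nonneg c (le_of_lt hy)
  rw [inv_mul_le_iff₀ hm']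
  have : (m : ℝ) * (3 / 2 * (c + 1) / m) = 3 / 2 * (c + 1) := by field_simp
  rw [this]; linarith

lemma integral_chernoffBound_le_add {μ : Measure ℝ} [IsProbabilityMeasure μ] {c m : ℕ}
    (hm : 0 < m) (hc : c ≤ m) :
    ∫ p, chernoffBound c (m - m * p) ∂μ ≤ 3 / 2 * (c + 1) / m + ksDist μ uniform01 := by
  have hmono : Monotone fun p : ℝ => chernoffBound c (m - m * p) := fun x y h =>
    chernoffBound_antitone c (by gcongr)
  have := abs_integral_monotone_sub_le (μ := μ) (ν := uniform01) (c := 1) hmono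
    (fun x => chernoffBound_nonneg c _) (fun x => chernoffBound_le_one c _)
  rw [integral_uniform01] at this
  linarith [(abs_le.1 this).2, integral_chernoffBound_le hm hc]

end tail

end SplitConformal

namespace SplitConformal
open Finset

/-! ### Chernoff's bound for Poisson-binomial tails. -/

section chernoff

variable {ι : Type*} [Fintype ι] [DecidableEq ι]

lemma coeffSum_pow_card_sub (s : ℝ) (p : ι → ℝ) :
    coeffSum (fun j => s ^ (Fintype.card ι - j)) (bernProd univ p)
      = ∏ i, (p i + (1 - p i) * s) := by
  rw [coeffSum_bernProd_univ, Finset.prod_add, powerset_univ]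
  refine sum_congr rfl fun T _ => ?_
  rw [← compl_eq_univ_sdiff, prod_mul_distrib, prod_const, card_compl, mul_assoc]

/-- Chernoff's bound for the upper tail of a sum of independent Bernoulli variables. -/
theorem one_sub_coeffSum_below_le_chernoffBound {p : ι → ℝ} (hp : ∀ i, p i ∈ Set.Icc (0 : ℝ) 1)
    {c k : ℕ} (hk : k + c = Fintype.card ι) :
    1 - coeffSum (below k) (bernProd univ p)
      ≤ chernoffBound c (Fintype.card ι - ∑ i, p i) := by
  have hnn := bernProd_coeff_nonneg univ (fun i => (hp i).1) (fun i => (hp i).2)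
  have hdeg : (bernProd univ p).natDegree ≤ Fintype.card ι := bernProd_natDegree_le _ _
  have hone : (1 : ℝ) = coeffSum (fun _ => 1) (bernProd univ p) := by
    rw [coeffSum_const, bernProd_eval_one, mul_one]
  set x : ℝ := Fintype.card ι - ∑ i, p i with hx
  have hxsum : x = ∑ i, (1 - p i) := by simp [hx]
  rcases le_or_gt x c with h | h
  · rw [chernoffBound, max_eq_right (by linarith), chernoffTail_zero]
    have : coeffSum (fun _ => 0) (bernProd univ p) ≤ coeffSum (below k) (bernProd univ p) :=
      coeffSum_mono hdeg hnn fun j _ => by unfold below; split_ifs <;> norm_num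
    rw [coeffSum_const, zero_mul] at this
    linarith
  have hx0 : 0 < x := lt_of_le_of_lt (Nat.cast_nonneg c) h
  -- The minimiser of `s ^ (-c) * exp (-(1 - s) x)`, Chernoff's bound for at most `c` failures when
  -- their mean is `x`.
  set s : ℝ := c / x with hs
  have hs0 : 0 ≤ s := by positivity
  have hs1 : s ≤ 1 := by rw [hs, div_le_one hx0]; exact h.le
  have key : s ^ c * (1 - coeffSum (below k) (bernProd univ p)) ≤ Real.exp (-(x - c)) := by
    calc s ^ c * (1 - coeffSum (below k) (bernProd univ p))
        = coeffSum (fun j => s ^ c * (1 - below k j)) (bernProd univ p) := by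
          rw [coeffSum_mul_left, coeffSum_sub, ← hone]
      _ ≤ coeffSum (fun j => s ^ (Fintype.card ι - j)) (bernProd univ p) := by
          refine coeffSum_mono hdeg hnn fun j hj => ?_
          unfold below
          split_ifs with hjk
          · simp only [sub_self, mul_zero]; positivity
          · rw [sub_zero, mul_one]
            exact pow_le_pow_of_le_one hs0 hs1 (by lia)
      _ = ∏ i, (p i + (1 - p i) * s) := coeffSum_pow_card_sub s p
      _ ≤ ∏ i, Real.exp (-((1 - s) * (1 - p i))) := by
          refine prod_le_prod (fun i _ => ?_) fun i _ => ?_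
          · have := (hp i).1
            have : 0 ≤ 1 - p i := by linarith [(hp i).2]
            positivity
          · have := Real.add_one_le_exp (-((1 - s) * (1 - p i)))
            linarith
      _ = Real.exp (-(x - c)) := by
          rw [← Real.exp_sum, sum_neg_distrib, ← mul_sum, ← hxsum, hs]
          congr 2
          field_simp
  rw [chernoffBound, max_eq_left (by linarith), chernoffTail]
  rcases Nat.eq_zero_or_pos c with rfl | hc
  · simpa using key
  have hc' : (0 : ℝ) < c := by exact_mod_cast hc
  have e : (x - c) / c + 1 = x / c := by field_simp; ring
  have e2 : (x / c) ^ c * s ^ c = 1 := by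
    rw [← mul_pow, hs]
    have : x / c * (c / x) = 1 := by field_simp
    rw [this, one_pow]
  rw [e]
  calc _ = (x / c) ^ c * (s ^ c * (1 - coeffSum (below k) (bernProd univ p))) := by
        rw [← mul_assoc, e2, one_mul]
    _ ≤ _ := by gcongr

end chernoff

/-! ### Coverage as a count. -/

section orderStatistics

/-- Counting strict inequalities keeps the equivalence exact in the presence of ties. For `k = m +
1` both sides always hold. -/
lemma le_orderStat_iff {m : ℕ} (v : Fin m → ℝ) {k : ℕ} (hk0 : 0 < k) (hk : k ≤ m + 1) (x : ℝ) :
    (x : EReal) ≤ orderStat v k ↔ #{i | v i < x} < k := by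
  unfold orderStat
  rw [if_neg hk0.ne']
  split_ifs with h
  · rw [EReal.coe_le_coe_iff]
    have hcard : #{i | (v ∘ Tuple.sort v) i < x} = #{i | v i < x} :=
      card_equiv (Tuple.sort v) fun i => by simp
    have := Tuple.lt_card_lt_iff_apply_lt_of_monotone (j := ⟨k - 1, h⟩) (a := x)
      (Tuple.monotone_sort v)
    rw [hcard] at this
    rw [← not_lt, ← Function.comp_apply (f := v), ← this]
    simp only [not_lt]
    lia
  · simp only [le_top, true_iff]
    have := card_le_univ (α := Fin m) {i | v i < x}
    rw [Fintype.card_fin] at this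
    lia

lemma mem_predSet_iff {𝒳 𝒴 : Type*} {m : ℕ} (R : 𝒳 → 𝒴 → ℝ) (x : Fin m → 𝒳) (y : Fin m → 𝒴)
    {k : ℕ} (hk0 : 0 < k) (hk : k ≤ m + 1) (x' : 𝒳) (y' : 𝒴) :
    y' ∈ predSet R x y k x' ↔ #{i | R (x i) (y i) < R x' y'} < k :=
  le_orderStat_iff _ hk0 hk _

end orderStatistics

/-! ### Conditioning on the test score. -/

section law

/-- The event splits according to the set `T` of coordinates below `z`; each piece is a box, with
product measure. -/
lemma pi_real_card_lt {m : ℕ} (ρ : Fin m → Measure ℝ) [∀ i, IsProbabilityMeasure (ρ i)] (z : ℝ)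
    (k : ℕ) :
    (Measure.pi ρ).real {w | #{j | w j < z} < k}
      = coeffSum (below k) (bernProd univ fun j => (ρ j).real (Set.Iio z)) := by
  set A : Finset (Fin m) → Set (Fin m → ℝ) := fun T =>
    Set.univ.pi fun j => if j ∈ T then Set.Iio z else (Set.Iio z)ᶜ with hA
  have hmemA : ∀ T w, w ∈ A T ↔ ({j | w j < z} : Finset (Fin m)) = T := by
    intro T w
    simp only [hA, Set.mem_pi, Set.mem_univ, true_imp_iff, Finset.ext_iff, mem_filter, mem_univ,
      true_and]
    refine forall_congr' fun j => ?_
    split_ifs with h <;> simp [h]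
  have hU : {w : Fin m → ℝ | #{j | w j < z} < k}
      = ⋃ T ∈ (univ.filter fun T : Finset (Fin m) => #T < k), A T := by
    ext w
    simp [hmemA]
  rw [hU, measureReal_biUnion_finset, coeffSum_bernProd_univ, sum_filter]
  · refine sum_congr rfl fun T _ => ?_
    have hpr : (Measure.pi ρ).real (A T)
        = (∏ i ∈ T, (ρ i).real (Set.Iio z)) * ∏ i ∈ Tᶜ, (1 - (ρ i).real (Set.Iio z)) := by
      rw [measureReal_def, hA, Measure.pi_pi, ENNReal.toReal_prod, ← prod_mul_prod_compl T]
      congr 1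
      · refine prod_congr rfl fun i hi => ?_
        rw [if_pos hi, measureReal_def]
      · refine prod_congr rfl fun i hi => ?_
        rw [if_neg (mem_compl.1 hi), ← measureReal_def, probReal_compl_eq_one_sub measurableSet_Iio]
    unfold below
    split_ifs
    · rw [hpr, mul_one]
    · rw [mul_zero]
  · intro T _ T' _ hne
    rw [Function.onFun, Set.disjoint_left]
    intro w h1 h2
    exact hne (((hmemA _ _).1 h1).symm.trans ((hmemA _ _).1 h2))
  · intro T _
    refine MeasurableSet.univ_pi fun j => ?_
    split_ifs
    · exact measurableSet_Iio
    · exact measurableSet_Iio.compl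

lemma measurableSet_card_lt (m k : ℕ) :
    MeasurableSet {x : ℝ × (Fin m → ℝ) | #{j | x.2 j < x.1} < k} := by
  have : Measurable fun x : ℝ × (Fin m → ℝ) => #{j | x.2 j < x.1} := by
    simp only [card_filter]
    refine Finset.measurable_sum _ fun j _ => ?_
    exact Measurable.ite (measurableSet_lt (by fun_prop) (by fun_prop)) measurable_const
      measurable_const
  exact this (measurableSet_Iio (a := k))

variable {Ω : Type*} [MeasurableSpace Ω] {P : Measure Ω}

lemma strictCDF_eq {S : Ω → ℝ} (hS : Measurable S) (z : ℝ) :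
    strictCDF P S z = (P.map S).real (Set.Iio z) := by
  rw [map_measureReal_apply hS measurableSet_Iio]; rfl

lemma card_mul_avgCDF {m : ℕ} (hm : 1 ≤ m) (S : Fin (m + 1) → Ω → ℝ) (z : ℝ) :
    m * avgCDF P S z = ∑ i : Fin m, strictCDF P (S i.castSucc) z := by
  have : (m : ℝ) ≠ 0 := by positivity
  unfold avgCDF
  field_simp

variable [IsProbabilityMeasure P]

lemma strictCDF_mem (S : Ω → ℝ) (z : ℝ) : strictCDF P S z ∈ Set.Icc (0 : ℝ) 1 :=
  ⟨measureReal_nonneg, measureReal_le_one⟩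

lemma strictCDF_mono (S : Ω → ℝ) : Monotone (strictCDF P S) := fun _ _ h =>
  measureReal_mono fun _ hω => lt_of_lt_of_le hω h

/-- The probability that fewer than `k` calibration scores lie below the test score, given that
the latter equals `z`. -/
noncomputable def condCover {m : ℕ} (P : Measure Ω) (S : Fin (m + 1) → Ω → ℝ) (k : ℕ) (z : ℝ) :
    ℝ :=
  coeffSum (below k) (bernProd univ fun j : Fin m => strictCDF P (S j.castSucc) z)

/-- By independence the joint law is a product; split off the test coordinate and apply Fubini. -/
theorem real_card_lt_eq_integral {m : ℕ} {S : Fin (m + 1) → Ω → ℝ} (hmeas : ∀ i, Measurable (S i))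
    (hindep : iIndepFun S P) (k : ℕ) :
    P.real {ω | #{j : Fin m | S j.castSucc ω < S (Fin.last m) ω} < k}
      = ∫ ω, condCover P S k (S (Fin.last m) ω) ∂P := by
  have hpr : ∀ i, IsProbabilityMeasure (P.map (S i)) := fun i =>
    Measure.isProbabilityMeasure_map (hmeas i).aemeasurable
  set E : Set (ℝ × (Fin m → ℝ)) := {x | #{j | x.2 j < x.1} < k} with hE
  have hEm : MeasurableSet E := measurableSet_card_lt m k
  have hmap := hindep.map_fun_eq_pi_map fun i => (hmeas i).aemeasurable
  have hmp := measurePreserving_piFinSuccAbove (fun i => P.map (S i)) (Fin.last m)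
  have hjoint : P.real {ω | #{j : Fin m | S j.castSucc ω < S (Fin.last m) ω} < k}
      = ((P.map (S (Fin.last m))).prod
          (Measure.pi fun j : Fin m => P.map (S ((Fin.last m).succAbove j)))).real E := by
    rw [← hmp.measureReal_preimage hEm.nullMeasurableSet, ← hmap, map_measureReal_apply
      (measurable_pi_lambda _ hmeas) ((MeasurableEquiv.measurable _) hEm)]
    congr 1
    ext ω
    simp only [hE, Set.mem_preimage, Set.mem_ofPred_eq, MeasurableEquiv.piFinSuccAbove_apply,
      Fin.insertNthEquiv_symm_apply, Fin.removeNth, Fin.succAbove_last]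
  rw [hjoint, measureReal_def, Measure.prod_apply hEm, ← integral_toReal
    (measurable_measure_prodMk_left hEm).aemeasurable
    (Filter.Eventually.of_forall fun z => measure_lt_top _ _)]
  have hslice : ∀ z, ((Measure.pi fun j : Fin m => P.map (S ((Fin.last m).succAbove j)))
      (Prod.mk z ⁻¹' E)).toReal = condCover P S k z := by
    intro z
    rw [← measureReal_def]
    refine (pi_real_card_lt _ z k).trans ?_
    simp only [condCover, Fin.succAbove_last, strictCDF_eq (hmeas _)]
  have hmeasf := (measurable_measure_prodMk_left
    (ν := Measure.pi fun j : Fin m => P.map (S ((Fin.last m).succAbove j))) hEm).ennreal_toReal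
  simp only [hslice] at hmeasf ⊢
  exact integral_map (hmeas _).aemeasurable hmeasf.aestronglyMeasurable

lemma measurable_condCover {m : ℕ} (S : Fin (m + 1) → Ω → ℝ) (k : ℕ) :
    Measurable (condCover P S k) := by
  unfold condCover
  simp only [coeffSum_bernProd_univ]
  refine Finset.measurable_sum _ fun T _ => Measurable.mul_const (Measurable.mul ?_ ?_) _
  · exact Finset.measurable_prod _ fun i _ => (strictCDF_mono _).measurable
  · exact Finset.measurable_prod _ fun i _ => (strictCDF_mono _).measurable.const_sub _

lemma condCover_abs_le_one {m : ℕ} (S : Fin (m + 1) → Ω → ℝ) (k : ℕ) (z : ℝ) :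
    |condCover P S k z| ≤ 1 :=
  abs_coeffSum_le le_rfl (bernProd_coeff_nonneg _ (fun _ => (strictCDF_mem _ _).1)
    fun _ => (strictCDF_mem _ _).2) (bernProd_eval_one _ _) fun j _ => by
      unfold below; split_ifs <;> norm_num

lemma avgCDF_mono {m : ℕ} (S : Fin (m + 1) → Ω → ℝ) : Monotone (avgCDF P S) := fun _ _ h =>
  mul_le_mul_of_nonneg_left (sum_le_sum fun _ _ => strictCDF_mono _ h) (by positivity)

lemma avgCDF_mem {m : ℕ} (hm : 1 ≤ m) (S : Fin (m + 1) → Ω → ℝ) (z : ℝ) :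
    avgCDF P S z ∈ Set.Icc (0 : ℝ) 1 := by
  have hm' : (0 : ℝ) < m := by exact_mod_cast hm
  have e := card_mul_avgCDF (P := P) hm S z
  have h0 : 0 ≤ ∑ i : Fin m, strictCDF P (S i.castSucc) z :=
    sum_nonneg fun i _ => (strictCDF_mem _ _).1
  have h1 : ∑ i : Fin m, strictCDF P (S i.castSucc) z ≤ m := by
    refine (sum_le_sum fun i _ => (strictCDF_mem _ _).2).trans ?_
    simp
  constructor
  · by_contra h
    have := mul_neg_of_pos_of_neg hm' (not_le.1 h)
    linarith
  · by_contra h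
    have := mul_lt_mul_of_pos_left (not_le.1 h) hm'
    linarith

/-- The mean minimises the sum of squares. Deviations can thus be taken from the test score's
`F_{m+1}(z)`, where `κ_i` bounds them. -/
lemma sum_sq_sub_mean_le {ι : Type*} [Fintype ι] (p : ι → ℝ) {a : ℝ} (h : ∑ i, (p i - a) = 0)
    (b : ℝ) : ∑ i, (p i - a) ^ 2 ≤ ∑ i, (p i - b) ^ 2 := by
  have e : ∀ i, (p i - b) ^ 2 = (p i - a) ^ 2 + 2 * (a - b) * (p i - a) + (a - b) ^ 2 := fun i => by
    ring
  simp only [e, sum_add_distrib, ← mul_sum, h, mul_zero, add_zero]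
  exact le_add_of_nonneg_right (sum_nonneg fun _ _ => sq_nonneg _)

lemma abs_condCover_sub_binCDF_le {m : ℕ} (hm : 1 ≤ m) {S : Fin (m + 1) → Ω → ℝ}
    (hmeas : ∀ i, Measurable (S i)) {k : ℕ} (hk : k ≤ m + 1) (z : ℝ) :
    |condCover P S k z - binCDF m (avgCDF P S z) k|
      ≤ approxWeight m (avgCDF P S z) * ∑ i : Fin m, kappa P S i ^ 2 := by
  have hpr : ∀ i, IsProbabilityMeasure (P.map (S i)) := fun i =>
    Measure.isProbabilityMeasure_map (hmeas i).aemeasurable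
  have hsum : ∑ i : Fin m, (strictCDF P (S i.castSucc) z - avgCDF P S z) = 0 := by
    rw [sum_sub_distrib, ← card_mul_avgCDF hm]; simp
  have := abs_coeffSum_below_sub_le (p := fun i : Fin m => strictCDF P (S i.castSucc) z)
    (fun i => strictCDF_mem _ _) (avgCDF_mem hm S z) hsum (k := k) (by simpa using hk)
  rw [Fintype.card_fin] at this
  refine this.trans (mul_le_mul_of_nonneg_left ?_ (approxWeight_nonneg _ _))
  refine (sum_sq_sub_mean_le _ hsum (strictCDF P (S (Fin.last m)) z)).trans
    (sum_le_sum fun i _ => ?_)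
  rw [← sq_abs]
  refine pow_le_pow_left₀ (abs_nonneg _) ?_ 2
  rw [strictCDF_eq (hmeas _), strictCDF_eq (hmeas _)]
  exact abs_measureReal_Iio_sub_le z

theorem abs_integral_condCover_sub_le {m : ℕ} (hm : 1 ≤ m) {S : Fin (m + 1) → Ω → ℝ}
    (hmeas : ∀ i, Measurable (S i)) {k : ℕ} (hk : k ≤ m + 1) :
    |∫ ω, condCover P S k (S (Fin.last m) ω) ∂P - k / (m + 1)| ≤ slack P S := by
  set a : Ω → ℝ := fun ω => avgCDF P S (S (Fin.last m) ω) with ha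
  have hameas : Measurable a := (avgCDF_mono S).measurable.comp (hmeas _)
  have hprob : IsProbabilityMeasure (P.map a) :=
    Measure.isProbabilityMeasure_map hameas.aemeasurable
  have hamem : ∀ ω, a ω ∈ Set.Icc (0 : ℝ) 1 := fun ω => avgCDF_mem hm S _
  have i₁ : Integrable (fun ω => condCover P S k (S (Fin.last m) ω)) P :=
    Integrable.of_bound ((measurable_condCover S k).comp (hmeas _)).aestronglyMeasurable 1
      (Filter.Eventually.of_forall fun ω => condCover_abs_le_one S k _)
  have i₂ : Integrable (fun ω => binCDF m (a ω) k) P :=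
    Integrable.of_bound
      ((continuous_binCDF m k).measurable.comp hameas).aestronglyMeasurable 1
      (Filter.Eventually.of_forall fun ω => by
        rw [Real.norm_of_nonneg (binCDF_nonneg (hamem ω).1 (hamem ω).2 k)]
        exact binCDF_le_one (hamem ω).1 (hamem ω).2 hk)
  have i₃ : Integrable (fun ω => approxWeight m (a ω)) P :=
    Integrable.of_bound
      ((continuous_approxWeight m).measurable.comp hameas).aestronglyMeasurable (1 / 2)
      (Filter.Eventually.of_forall fun ω => by
        rw [Real.norm_of_nonneg (approxWeight_nonneg _ _)]
        exact approxWeight_le_half _ _)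
  have hbin : |∫ ω, binCDF m (a ω) k ∂P - k / (m + 1)| ≤ avgKS P S := by
    have := abs_integral_clampedBinCDF_sub_le (μ := P.map a) hm hk
    have hc : Continuous (clampedBinCDF m k) :=
      (continuous_binCDF m k).comp (continuous_subtype_val.comp continuous_projIcc)
    rw [integral_map hameas.aemeasurable hc.aestronglyMeasurable] at this
    simp only [clampedBinCDF_of_mem (hamem _)] at this
    exact this
  have hw : ∫ ω, approxWeight m (a ω) ∂P ≤ IConst m + avgKS P S := by
    have := integral_approxWeight_le_add (μ := P.map a) m
    rw [integral_map hameas.aemeasurable (continuous_approxWeight m).aestronglyMeasurable] at this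
    exact this.trans (add_le_add_left (integral_approxWeight_le_IConst m) _)
  have hK : 0 ≤ ∑ i : Fin m, kappa P S i ^ 2 := sum_nonneg fun _ _ => sq_nonneg _
  have hdiff : |∫ ω, condCover P S k (S (Fin.last m) ω) ∂P - ∫ ω, binCDF m (a ω) k ∂P|
      ≤ (∑ i : Fin m, kappa P S i ^ 2) * (IConst m + avgKS P S) := by
    rw [← integral_sub i₁ i₂]
    refine (abs_integral_le_integral_abs).trans ?_
    refine (integral_mono (i₁.sub i₂).abs (i₃.mul_const _)
      fun ω => abs_condCover_sub_binCDF_le hm hmeas hk _).trans ?_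
    rw [integral_mul_const, mul_comm]
    exact mul_le_mul_of_nonneg_left hw hK
  unfold slack
  have := abs_sub_le (∫ ω, condCover P S k (S (Fin.last m) ω) ∂P) (∫ ω, binCDF m (a ω) k ∂P)
    (k / (m + 1))
  linarith

theorem le_integral_condCover {m : ℕ} (hm : 1 ≤ m) {S : Fin (m + 1) → Ω → ℝ}
    (hmeas : ∀ i, Measurable (S i)) {k c : ℕ} (hk : k + c = m) :
    1 - (3 / 2 * (c + 1) / m + avgKS P S) ≤ ∫ ω, condCover P S k (S (Fin.last m) ω) ∂P := by
  set a : Ω → ℝ := fun ω => avgCDF P S (S (Fin.last m) ω) with ha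
  have hameas : Measurable a := (avgCDF_mono S).measurable.comp (hmeas _)
  have hprob : IsProbabilityMeasure (P.map a) :=
    Measure.isProbabilityMeasure_map hameas.aemeasurable
  have i₁ : Integrable (fun ω => condCover P S k (S (Fin.last m) ω)) P :=
    Integrable.of_bound ((measurable_condCover S k).comp (hmeas _)).aestronglyMeasurable 1
      (Filter.Eventually.of_forall fun ω => condCover_abs_le_one S k _)
  have hgm : Measurable fun p : ℝ => chernoffBound c (m - m * p) :=
    (chernoffBound_antitone c).measurable.comp (by fun_prop)
  have i₂ : Integrable (fun ω => chernoffBound c (m - m * a ω)) P :=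
    Integrable.of_bound (hgm.comp hameas).aestronglyMeasurable 1
      (Filter.Eventually.of_forall fun ω => by
        rw [Real.norm_of_nonneg (chernoffBound_nonneg _ _)]
        exact chernoffBound_le_one _ _)
  have hb := integral_chernoffBound_le_add (μ := P.map a) (c := c) (m := m) (by lia) (by lia)
  rw [integral_map hameas.aemeasurable hgm.aestronglyMeasurable] at hb
  have hpt : ∀ ω, 1 - condCover P S k (S (Fin.last m) ω) ≤ chernoffBound c (m - m * a ω) := by
    intro ω
    have := one_sub_coeffSum_below_le_chernoffBound
      (p := fun i : Fin m => strictCDF P (S i.castSucc) (S (Fin.last m) ω))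
      (fun i => strictCDF_mem _ _) (c := c) (k := k) (by simpa using hk)
    rwa [Fintype.card_fin, ← card_mul_avgCDF hm] at this
  have hle_int := integral_mono ((integrable_const (1 : ℝ)).sub i₁) i₂ hpt
  rw [integral_sub' (integrable_const _) i₁] at hle_int
  simp only [integral_const, probReal_univ, smul_eq_mul, mul_one] at hle_int
  have : ksDist (P.map a) uniform01 = avgKS P S := rfl
  linarith

end law

end SplitConformal

/-! ### Coverage at the two ranks. -/

theorem mainTheorem8 {Ω 𝒳 𝒴 : Type*} [MeasurableSpace Ω] (P : Measure Ω) [IsProbabilityMeasure P]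
    (m : ℕ) (hm : 1 ≤ m) (α : ℝ) (hα₀ : 0 < α) (hα₁ : α < 1)
    (R : 𝒳 → 𝒴 → ℝ) (X : Fin (m + 1) → Ω → 𝒳) (Y : Fin (m + 1) → Ω → 𝒴)
    (S : Fin (m + 1) → Ω → ℝ) (hS : ∀ i ω, S i ω = R (X i ω) (Y i ω))
    (hmeas : ∀ i, Measurable (S i)) (hindep : iIndepFun S P)
    (hcont : ∀ i (z : ℝ), P {ω | S i ω = z} = 0) :
    (-SplitConformal.slack P S ≤
        P.real {ω | Y (Fin.last m) ω ∈ SplitConformal.conformalSet R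
          (fun i : Fin m => X i.castSucc ω) (fun i : Fin m => Y i.castSucc ω) α
          (X (Fin.last m) ω)} - (1 - α) ∧
      P.real {ω | Y (Fin.last m) ω ∈ SplitConformal.conformalSet R
          (fun i : Fin m => X i.castSucc ω) (fun i : Fin m => Y i.castSucc ω) α
          (X (Fin.last m) ω)} - (1 - α) ≤ 1 / ((m : ℝ) + 1) + SplitConformal.slack P S) ∧
    P.real {ω | Y (Fin.last m) ω ∈ SplitConformal.modConformalSet R
          (fun i : Fin m => X i.castSucc ω) (fun i : Fin m => Y i.castSucc ω) α
          (X (Fin.last m) ω)} - (1 - α) ≥ -3 * SplitConformal.avgKS P S := by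
  have hm' : (0 : ℝ) < m := by exact_mod_cast hm
  have hcover : ∀ k : ℕ, 0 < k → k ≤ m + 1 →
      P.real {ω | Y (Fin.last m) ω ∈ SplitConformal.predSet R
          (fun i : Fin m => X i.castSucc ω) (fun i : Fin m => Y i.castSucc ω) k
          (X (Fin.last m) ω)}
        = ∫ ω, SplitConformal.condCover P S k (S (Fin.last m) ω) ∂P := by
    intro k hk0 hk
    rw [← SplitConformal.real_card_lt_eq_integral hmeas hindep]
    congr 1
    ext ω
    rw [Set.mem_ofPred_eq, Set.mem_ofPred_eq, SplitConformal.mem_predSet_iff R _ _ hk0 hk]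
    simp only [hS]
  have hKS : 0 ≤ SplitConformal.avgKS P S := SplitConformal.ksDist_nonneg _ _
  refine ⟨?_, ?_⟩
  · have hpos : 0 < ((m : ℝ) + 1) * (1 - α) := mul_pos (by linarith) (by linarith)
    set k := ⌈((m : ℝ) + 1) * (1 - α)⌉₊ with hk
    have hk0 : 0 < k := Nat.ceil_pos.2 hpos
    have hk1 : k ≤ m + 1 := by
      refine Nat.ceil_le.2 ?_
      push_cast
      nlinarith
    have hlo : 1 - α ≤ k / ((m : ℝ) + 1) := by
      rw [le_div_iff₀ (by linarith), mul_comm]; exact Nat.le_ceil _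
    -- Rounding the rank up costs at most `1/(m + 1)`, and only in the upper bound.
    have hhi : k / ((m : ℝ) + 1) ≤ 1 - α + 1 / ((m : ℝ) + 1) := by
      have h := (Nat.ceil_lt_add_one hpos.le).le
      rw [← hk] at h
      rw [div_le_iff₀ (by linarith)]
      have : (1 - α + 1 / ((m : ℝ) + 1)) * ((m : ℝ) + 1) = ((m : ℝ) + 1) * (1 - α) + 1 := by
        field_simp
      linarith
    have hb := abs_le.1 (SplitConformal.abs_integral_condCover_sub_le (P := P) hm hmeas hk1)
    rw [← hcover k hk0 hk1] at hb
    unfold SplitConformal.conformalSet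
    rw [← hk]
    constructor <;> linarith [hb.1, hb.2]
  · unfold SplitConformal.modConformalSet
    set t := ⌊2 * (m : ℝ) * α / 3⌋₊ with ht
    have htle : (t : ℝ) ≤ 2 * (m : ℝ) * α / 3 := Nat.floor_le (by positivity)
    have htm : t ≤ m := by
      have : (t : ℝ) ≤ m := by nlinarith
      exact_mod_cast this
    rw [hcover _ (by lia) (by lia)]
    -- For `t = 0` the rank is `m + 1`, the threshold is `+∞` and coverage is certain. Otherwise `c
    -- = t - 1` is `m` minus the rank.
    rcases Nat.eq_zero_or_pos t with h0 | h0
    · have := hcover (m + 1) (by lia) le_rfl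
      rw [h0, Nat.sub_zero, ← this]
      have huniv : {ω | Y (Fin.last m) ω ∈ SplitConformal.predSet R
          (fun i : Fin m => X i.castSucc ω) (fun i : Fin m => Y i.castSucc ω) (m + 1)
          (X (Fin.last m) ω)} = Set.univ := by
        ext ω
        simp [SplitConformal.predSet, SplitConformal.orderStat]
      rw [huniv, probReal_univ]
      linarith
    · obtain ⟨c, hc⟩ : ∃ c, t = c + 1 := ⟨t - 1, by lia⟩
      have := SplitConformal.le_integral_condCover (P := P) hm hmeas
        (k := m + 1 - t) (c := c) (by lia)
      have h2 : 3 / 2 * ((c : ℝ) + 1) / m ≤ α := by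
        rw [div_le_iff₀ hm']
        rw [hc] at htle
        push_cast at htle
        linarith
      linarith
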